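/- All functions are real valued, and functions that agree almost everywhere are identified. For $\sigma>0$ the left and right Riemann–Liouville integrals of $u$ are $$\boldsymbol{D}^{-\sigma}u(x)=\frac1{\Gamma(\sigma)}\int_{-\infty}^{x}(x-y)^{\sigma-1}u(y)\,dy,\qquad \boldsymbol{D}^{-\sigma*}u(x)=\frac1{\Gamma(\sigma)}\int_{x}^{\infty}(y-x)^{\sigma-1}u(y)\,dy,$$ the integrals converging absolutely for almost every $x$. For $\mu>0$ and $\psi\in C_0^\infty(\mathbb{R})$, with $n$ the smallest integer greater than $\mu$, put $\boldsymbol{D}^{\mu}\psi=\frac{d^n}{dx^n}\boldsymbol{D}^{-(n-\mu)}\psi$ and $\boldsymbol{D}^{\mu*}\psi=(-1)^n\frac{d^n}{dx^n}\boldsymbol{D}^{-(n-\mu)*}\psi$. For $u,w\in L^1_{\mathrm{loc}}(\mathbb{R})$ write $w=\boldsymbol{D}^{\mu}u$ (weak left fractional derivative) if $\int_{\mathbb{R}} u\,\boldsymbol{D}^{\mu*}\psi=\int_{\mathbb{R}} w\,\psi$ for all $\psi\in C_0^\infty(\mathbb{R})$, and $w=\boldsymbol{D}^{\mu*}u$ (weak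 right fractional derivative) if $\int_{\mathbb{R}} u\,\boldsymbol{D}^{\mu}\psi=\int_{\mathbb{R}} w\,\psi$ for all $\psi\in C_0^\infty(\mathbb{R})$, the integrals on the left converging absolutely. Put $\boldsymbol{D}^{0}u=\boldsymbol{D}^{0*}u=u$. For $\mu\ge 0$ let $$\widehat H^{\mu}(\mathbb{R})=\Big\{w\in L^2(\mathbb{R}):\int_{\mathbb{R}}\big(1+|2\pi\xi|^{2\mu}\big)|\widehat w(\xi)|^2\,d\xi<\infty\Big\},$$ where $\widehat w$ is the Plancherel transform, which extends $\widehat w(\xi)=\int_{\mathbb{R}} e^{-2\pi i x\xi}w(x)\,dx$ from $L^1\cap L^2$ to $L^2$. **Theorem.** Let $-1/2<s<1/2$ and $f\in L^2(\mathbb{R})$. (1) There is a unique $u\in\widehat H^{|s|}(\mathbb{R})$ such that $$f=\boldsymbol{D}^{-s}u+\boldsymbol{D}^{s*}u .$$ Furthermore, for every $t>0$, $f\in\widehat H^{t}(\mathbb{R})$ if and only if $u\in\widehat H^{|s|+t}(\mathbb{R})$. (2) There is a unique $u\in\widehat H^{|s|}(\mathbb{R})$ such that $$f=\boldsymbol{D}^{-s}u+\boldsymbol{D}^{s}u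 .$$ Furthermore, for every $t>0$, $f\in\widehat H^{t}(\mathbb{R})$ if and only if $u\in\widehat H^{|s|+t}(\mathbb{R})$. Here an operator of positive order is the weak fractional derivative, one of negative order is the Riemann–Liouville integral, and one of order $0$ is the identity. -/

import Mathlib

open MeasureTheory Set
open scoped FourierTransform ContDiff

noncomputable section

/-- Left Riemann–Liouville integral of order `σ > 0`:
`(1 / Γ(σ)) ∫_{-∞}^x (x - y)^(σ-1) u(y) dy`. -/
def leftRLIntegral (σ : ℝ) (u : ℝ → ℝ) (x : ℝ) : ℝ :=
  1 / Real.Gamma σ * ∫ y in Iio x, (x - y) ^ (σ - 1) * u y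

/-- Right Riemann–Liouville integral of order `σ > 0`:
`(1 / Γ(σ)) ∫_x^∞ (y - x)^(σ-1) u(y) dy`. -/
def rightRLIntegral (σ : ℝ) (u : ℝ → ℝ) (x : ℝ) : ℝ :=
  1 / Real.Gamma σ * ∫ y in Ioi x, (y - x) ^ (σ - 1) * u y

/-- Classical left Riemann–Liouville derivative of order `μ > 0`: the `n`-th derivative of the
left integral of order `n - μ`, with `n` the smallest integer greater than `μ`. -/
def leftRLDeriv (μ : ℝ) (u : ℝ → ℝ) : ℝ → ℝ :=
  iteratedDeriv (⌊μ⌋₊ + 1) (leftRLIntegral (((⌊μ⌋₊ + 1 : ℕ) : ℝ) - μ) u)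

/-- Classical right Riemann–Liouville derivative of order `μ > 0`: `(-1)^n` times the `n`-th
derivative of the right integral of order `n - μ`, with `n` the smallest integer greater
than `μ`. -/
def rightRLDeriv (μ : ℝ) (u : ℝ → ℝ) (x : ℝ) : ℝ :=
  (-1) ^ (⌊μ⌋₊ + 1) *
    iteratedDeriv (⌊μ⌋₊ + 1) (rightRLIntegral (((⌊μ⌋₊ + 1 : ℕ) : ℝ) - μ) u) x

/-- `w` is the weak left fractional derivative of order `μ > 0` of `u`: both are locally
integrable and `(u, D^{μ*} ψ) = (w, ψ)` for every test function `ψ`. -/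
def IsWeakLeftDeriv (μ : ℝ) (u w : ℝ → ℝ) : Prop :=
  LocallyIntegrable u ∧ LocallyIntegrable w ∧
    ∀ ψ : ℝ → ℝ, ContDiff ℝ ∞ ψ → HasCompactSupport ψ →
      Integrable (fun x => u x * rightRLDeriv μ ψ x) ∧
        ∫ x, u x * rightRLDeriv μ ψ x = ∫ x, w x * ψ x

/-- `w` is the weak right fractional derivative of order `μ > 0` of `u`: both are locally
integrable and `(u, D^μ ψ) = (w, ψ)` for every test function `ψ`. -/
def IsWeakRightDeriv (μ : ℝ) (u w : ℝ → ℝ) : Prop :=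
  LocallyIntegrable u ∧ LocallyIntegrable w ∧
    ∀ ψ : ℝ → ℝ, ContDiff ℝ ∞ ψ → HasCompactSupport ψ →
      Integrable (fun x => u x * leftRLDeriv μ ψ x) ∧
        ∫ x, u x * leftRLDeriv μ ψ x = ∫ x, w x * ψ x

/-- `w = D^μ u` almost everywhere, for a real order `μ`: a weak left derivative if `μ > 0`,
the identity if `μ = 0`, and the left Riemann–Liouville integral of order `-μ`, whose defining
integral converges absolutely at almost every point, if `μ < 0`. -/
def IsLeftRL (μ : ℝ) (u w : ℝ → ℝ) : Prop :=
  (0 < μ → IsWeakLeftDeriv μ u w) ∧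
  (μ = 0 → w =ᵐ[volume] u) ∧
  (μ < 0 →
    (∀ᵐ x : ℝ, IntegrableOn (fun y => (x - y) ^ (-μ - 1) * u y) (Iio x)) ∧
      w =ᵐ[volume] leftRLIntegral (-μ) u)

/-- `w = D^{μ*} u` almost everywhere, for a real order `μ`: a weak right derivative if `μ > 0`,
the identity if `μ = 0`, and the right Riemann–Liouville integral of order `-μ`, whose defining
integral converges absolutely at almost every point, if `μ < 0`. -/
def IsRightRL (μ : ℝ) (u w : ℝ → ℝ) : Prop :=
  (0 < μ → IsWeakRightDeriv μ u w) ∧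
  (μ = 0 → w =ᵐ[volume] u) ∧
  (μ < 0 →
    (∀ᵐ x : ℝ, IntegrableOn (fun y => (y - x) ^ (-μ - 1) * u y) (Ioi x)) ∧
      w =ᵐ[volume] rightRLIntegral (-μ) u)

/-- The Plancherel transform of a real-valued square-integrable function. -/
def plancherel (u : Lp ℝ 2 (volume : Measure ℝ)) : Lp ℂ 2 (volume : Measure ℝ) :=
  𝓕 (Complex.ofRealCLM.compLp u)

/-- The Sobolev space `Ĥ^μ(ℝ)`, `μ ≥ 0`, of real-valued functions. -/
def sobolevHat (μ : ℝ) : Set (Lp ℝ 2 (volume : Measure ℝ)) :=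
  {u | Integrable (fun ξ : ℝ => (1 + |2 * Real.pi * ξ| ^ (2 * μ)) * ‖plancherel u ξ‖ ^ 2)}

/-- `f = D^{-s} u + D^{s*} u`. -/
def IsLeftRightDecomp (s : ℝ) (f u : ℝ → ℝ) : Prop :=
  ∃ a b : ℝ → ℝ, IsLeftRL (-s) u a ∧ IsRightRL s u b ∧ f =ᵐ[volume] fun x => a x + b x

/-- `f = D^{-s} u + D^{s} u`. -/
def IsLeftLeftDecomp (s : ℝ) (f u : ℝ → ℝ) : Prop :=
  ∃ a b : ℝ → ℝ, IsLeftRL (-s) u a ∧ IsLeftRL s u b ∧ f =ᵐ[volume] fun x => a x + b x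

end

/-! Everything is decided by Fourier multipliers. Let `e = 1` stand for left and `e = -1` for right,
and let s > 0; a negative order only exchanges the integral and the derivative. The integral of
order s multiplies û by (2πieξ)^(-s), the derivative by (2πieξ)^s, so both equations read f̂ = m û
with m a sum of one factor of each kind. The bases are purely imaginary, of argument ±π/2. With ρ =
|2πξ|, both terms therefore have real part cos(πs/2) times a power of ρ, whatever the signs
(`re_fracSymbol`). No cancellation is possible: cos(πs/2)(ρ^s + ρ^(-s)) ≤ |m| ≤ ρ^s + ρ^(-s)
(`le_norm_sumSymbol`, `norm_sumSymbol_le`). Thus 1/m is bounded and û = f̂/m is forced. At high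
frequency |m| is comparable to ρ^s, which accounts for the s extra derivatives of u.

The work lies in justifying the multipliers for u in L². The kernel is not integrable, so it is
damped by an exponential, transformed by a Laplace integral, and the damping is removed against test
functions (`plancherel_convolution_rlKernel`). Fubini then moves the kernel from u to the test
function (`integral_rlKernel_convolution_mul`). Here s < 1/2 is essential: it makes |ξ|^(-s) ψ̂
square integrable at the origin (`memLp_fracSymbol_neg_mul_fourier`). Finally,
`ae_eq_zero_of_integral_mul_conj_fourier` recovers f̂ = m û from its tested form. -/

open Filter
open scoped Topology Convolution ComplexConjugate SchwartzMap

/-! ### Laplace transform of a power, by analytic continuation -/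

/-- The Laplace transform of `t ^ (σ - 1)` on the right half plane. -/
theorem integral_rpow_mul_cexp_neg_mul_Ioi {σ : ℝ} (hσ : 0 < σ) {r : ℂ} (hr : 0 < r.re) :
    ∫ t in Ioi (0 : ℝ), ((t ^ (σ - 1) : ℝ) : ℂ) * Complex.exp (-(r * t)) =
      Real.Gamma σ * r ^ (-(σ : ℂ)) := by
  set F : ℂ → ℂ := fun r => ∫ t in Ioi (0 : ℝ), ((t ^ (σ - 1) : ℝ) : ℂ) * Complex.exp (-(r * t))
  set U : Set ℂ := {r | 0 < r.re}
  have hU : IsOpen U := isOpen_lt continuous_const Complex.continuous_re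
  have hmeas (p : ℝ) (r : ℂ) : AEStronglyMeasurable
      (fun t : ℝ => ((t ^ p : ℝ) : ℂ) * Complex.exp (-(r * t))) (volume.restrict (Ioi 0)) := by
    apply Measurable.aestronglyMeasurable
    fun_prop
  have hint (p : ℝ) (hp : -1 < p) (b : ℝ) (hb : 0 < b) :
      IntegrableOn (fun t : ℝ => t ^ p * Real.exp (-(b * t))) (Ioi 0) := by
    have := integrableOn_rpow_mul_exp_neg_mul_rpow hp one_pos hb
    refine this.congr_fun (fun t _ => ?_) measurableSet_Ioi
    simp
  have hF : DifferentiableOn ℂ F U := by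
    intro r₀ (hr₀ : 0 < r₀.re)
    refine DifferentiableAt.differentiableWithinAt ?_
    -- On this smaller half plane the derivative of the integrand has a bound independent of `z`.
    have hball : {z : ℂ | r₀.re / 2 < z.re} ∈ 𝓝 r₀ :=
      (isOpen_lt continuous_const Complex.continuous_re).mem_nhds
        (by simp only [mem_ofPred_eq]; linarith)
    refine (hasDerivAt_integral_of_dominated_loc_of_deriv_le
      (F' := fun z t => ((t ^ (σ - 1) : ℝ) : ℂ) * (Complex.exp (-(z * t)) * (-(1 * (t : ℂ)))))
      (bound := fun t => t ^ σ * Real.exp (-(r₀.re / 2 * t))) hball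
      (.of_forall fun z => hmeas _ z) ?_ ?_ ?_ ?_ ?_).2.differentiableAt
    · refine ((hint (σ - 1) (by linarith) r₀.re hr₀).mono' (hmeas _ _) ?_)
      filter_upwards [ae_restrict_mem measurableSet_Ioi] with t ht
      have ht : 0 < t := ht
      simp [Complex.norm_exp, abs_of_nonneg (Real.rpow_nonneg ht.le _)]
    · apply Measurable.aestronglyMeasurable
      fun_prop
    · filter_upwards [ae_restrict_mem measurableSet_Ioi] with t ht z hz
      have ht : 0 < t := ht
      have hz : r₀.re / 2 < z.re := hz
      have : t ^ σ = t ^ (σ - 1) * t := by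
        rw [← Real.rpow_add_one ht.ne', sub_add_cancel]
      simp only [norm_mul, Complex.norm_real, Real.norm_eq_abs, Complex.norm_exp, norm_neg,
        abs_of_nonneg (Real.rpow_nonneg ht.le _), one_mul, abs_of_pos ht, this, Complex.neg_re,
        Complex.re_mul_ofReal]
      rw [mul_comm (Real.exp _) t, ← mul_assoc]
      gcongr
    · exact hint σ (by linarith) _ (by linarith)
    · refine .of_forall fun t z _ => ?_
      exact ((((hasDerivAt_id z).mul_const (t : ℂ)).neg).cexp).const_mul _
  have hG : DifferentiableOn ℂ (fun r : ℂ => Real.Gamma σ * r ^ (-(σ : ℂ))) U := by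
    intro r₀ hr₀
    exact ((differentiableAt_id.cpow_const (Or.inl hr₀)).const_mul _).differentiableWithinAt
  have hreal (b : ℝ) (hb : 0 < b) : F b = Real.Gamma σ * (b : ℂ) ^ (-(σ : ℂ)) := by
    have := Complex.integral_cpow_mul_exp_neg_mul_Ioi (a := σ) (by simpa using hσ) hb
    rw [Complex.Gamma_ofReal] at this
    rw [mul_comm, Complex.cpow_neg, ← Complex.inv_cpow, ← one_div, ← this]
    · refine setIntegral_congr_fun measurableSet_Ioi fun t ht => ?_
      rw [Complex.ofReal_cpow (le_of_lt ht)]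
      simp
    · rw [Complex.arg_ofReal_of_nonneg hb.le]
      exact Real.pi_pos.ne
  -- Both sides are holomorphic and agree on the positive reals, which accumulate at 1.
  refine AnalyticOnNhd.eqOn_of_preconnected_of_frequently_eq (𝕜 := ℂ) (z₀ := 1)
    (hF.analyticOnNhd hU) (hG.analyticOnNhd hU)
    (convex_halfSpace_re_gt 0).isPreconnected (by simp [U]) ?_ hr
  have hT : Tendsto (fun n : ℕ => ((1 + 1 / ((n : ℝ) + 1) : ℝ) : ℂ)) atTop (𝓝[≠] 1) := by
    refine tendsto_nhdsWithin_iff.2 ⟨?_, .of_forall fun n => ?_⟩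
    · have := (tendsto_one_div_add_atTop_nhds_zero_nat (𝕜 := ℝ)).const_add 1
      rw [add_zero] at this
      exact (Complex.continuous_ofReal.tendsto' 1 1 (by simp)).comp this
    · simp only [mem_compl_iff, mem_singleton_iff]
      intro h
      have : 0 < 1 / ((n : ℝ) + 1) := by positivity
      linarith [Complex.ofReal_eq_one.1 h]
  exact hT.frequently (.of_forall fun n => hreal _ (by positivity))

/-! ### The damped kernel and its Fourier transform -/

/-- The exponentially damped Riemann–Liouville kernel. -/
noncomputable def rlKernel (e σ ε t : ℝ) : ℝ :=
  (Ioi (0 : ℝ)).indicator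
    (fun y => (Real.Gamma σ)⁻¹ * (y ^ (σ - 1) * Real.exp (-(ε * y)))) (e * t)

theorem rlKernel_neg (e σ ε t : ℝ) : rlKernel e σ ε (-t) = rlKernel (-e) σ ε t := by
  simp [rlKernel]

@[fun_prop]
theorem measurable_rlKernel (e σ ε : ℝ) : Measurable (rlKernel e σ ε) := by
  have : Measurable ((Ioi (0 : ℝ)).indicator
    (fun y => (Real.Gamma σ)⁻¹ * (y ^ (σ - 1) * Real.exp (-(ε * y))))) :=
    Measurable.indicator (by fun_prop) measurableSet_Ioi
  exact this.comp (measurable_const_mul e)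

theorem rlKernel_eq_exp_mul (e σ ε t : ℝ) :
    rlKernel e σ ε t = Real.exp (-(ε * (e * t))) * rlKernel e σ 0 t := by
  unfold rlKernel
  by_cases h : e * t ∈ Ioi (0 : ℝ)
  · simp only [indicator_of_mem h]
    simp
    ring
  · simp [indicator_of_notMem h]

theorem rlKernel_nonneg (e : ℝ) {σ : ℝ} (hσ : 0 < σ) (ε t : ℝ) : 0 ≤ rlKernel e σ ε t := by
  refine indicator_nonneg (fun y hy => ?_) _
  have hy : 0 < y := hy
  have := Real.Gamma_pos_of_pos hσ
  positivity

theorem rlKernel_le (e : ℝ) {σ : ℝ} (hσ : 0 < σ) {ε : ℝ} (hε : 0 ≤ ε) (t : ℝ) :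
    rlKernel e σ ε t ≤ rlKernel e σ 0 t := by
  by_cases h : e * t ∈ Ioi (0 : ℝ)
  · rw [rlKernel_eq_exp_mul]
    refine mul_le_of_le_one_left (rlKernel_nonneg e hσ 0 t) (Real.exp_le_one_iff.2 ?_)
    have h : 0 < e * t := h
    have : 0 ≤ ε * (e * t) := by positivity
    linarith
  · rw [rlKernel, rlKernel, indicator_of_notMem h, indicator_of_notMem h]

theorem tendsto_rlKernel (e σ t : ℝ) :
    Tendsto (fun ε => rlKernel e σ ε t) (𝓝 0) (𝓝 (rlKernel e σ 0 t)) := by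
  rw [funext fun ε => rlKernel_eq_exp_mul e σ ε t]
  have : Continuous fun ε : ℝ => Real.exp (-(ε * (e * t))) * rlKernel e σ 0 t := by fun_prop
  exact this.tendsto' 0 _ (by simp)

theorem integral_comp_sign_mul {E : Type*} [NormedAddCommGroup E] [NormedSpace ℝ E] {e : ℝ}
    (he : e = 1 ∨ e = -1) (g : ℝ → E) : ∫ t, g (e * t) = ∫ t, g t := by
  rcases he with rfl | rfl
  · simp
  · simpa using integral_neg_eq_self g volume

theorem integrable_comp_sign_mul {E : Type*} [NormedAddCommGroup E] {e : ℝ}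
    (he : e = 1 ∨ e = -1) {g : ℝ → E} (hg : Integrable g) : Integrable fun t => g (e * t) := by
  rcases he with rfl | rfl
  · simpa
  · simpa using hg.comp_neg

theorem integrable_rlKernel {e : ℝ} (he : e = 1 ∨ e = -1) {σ ε : ℝ} (hσ : 0 < σ) (hε : 0 < ε) :
    Integrable (rlKernel e σ ε) := by
  refine integrable_comp_sign_mul he (g := (Ioi (0 : ℝ)).indicator
    (fun y => (Real.Gamma σ)⁻¹ * (y ^ (σ - 1) * Real.exp (-(ε * y))))) ?_
  rw [integrable_indicator_iff measurableSet_Ioi]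
  refine Integrable.const_mul ?_ _
  have := integrableOn_rpow_mul_exp_neg_mul_rpow (show -1 < σ - 1 by linarith) one_pos hε
  refine this.congr_fun (fun t _ => ?_) measurableSet_Ioi
  simp

/-- Undoing the damping of an integrable kernel costs only a continuous factor. -/
theorem locallyIntegrable_rlKernel {e : ℝ} (he : e = 1 ∨ e = -1) {σ : ℝ} (hσ : 0 < σ) :
    LocallyIntegrable (rlKernel e σ 0) := by
  have h : rlKernel e σ 0 = fun t => Real.exp (e * t) * rlKernel e σ 1 t := by
    ext t
    rw [rlKernel_eq_exp_mul e σ 1 t, ← mul_assoc, ← Real.exp_add]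
    simp
  rw [h]
  have h1 := (integrable_rlKernel he hσ one_pos).locallyIntegrable
  rw [← locallyIntegrableOn_univ] at h1 ⊢
  exact h1.continuousOn_mul (Continuous.continuousOn (by fun_prop)) isOpen_univ.isLocallyClosed

/-- The substitution t ↦ et turns the Fourier integral into the Laplace integral at ε + 2πieξ,
because e² = 1. -/
theorem fourier_rlKernel {e : ℝ} (he : e = 1 ∨ e = -1) {σ ε : ℝ} (hσ : 0 < σ) (hε : 0 < ε)
    (ξ : ℝ) : 𝓕 (fun t => (rlKernel e σ ε t : ℂ)) ξ =
      (ε + ((2 * Real.pi * (e * ξ) : ℝ) : ℂ) * Complex.I) ^ (-(σ : ℂ)) := by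
  have hee : e * e = 1 := by rcases he with rfl | rfl <;> norm_num
  have hr : 0 < ((ε : ℂ) + ((2 * Real.pi * (e * ξ) : ℝ) : ℂ) * Complex.I).re := by simpa
  have hΓ : (Real.Gamma σ : ℂ) ≠ 0 := by exact_mod_cast (Real.Gamma_pos_of_pos hσ).ne'
  rw [Real.fourier_real_eq_integral_exp_smul]
  have := integral_rpow_mul_cexp_neg_mul_Ioi hσ hr
  rw [← mul_right_inj' hΓ, ← this, ← integral_indicator measurableSet_Ioi,
    ← integral_comp_sign_mul he ((Ioi (0 : ℝ)).indicator _), ← integral_const_mul]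
  congr 1
  ext t
  by_cases h : e * t ∈ Ioi (0 : ℝ)
  · simp only [rlKernel, indicator_of_mem h, smul_eq_mul]
    push_cast
    field_simp
    rw [mul_assoc, mul_left_comm, ← Complex.exp_add]
    congr 2
    have : (e : ℂ) * e = 1 := by exact_mod_cast hee
    linear_combination (2 * Real.pi * ξ * t * Complex.I : ℂ) * this
  · simp [rlKernel, indicator_of_notMem h]

/-! ### The multipliers on the imaginary axis -/

/-- The Fourier multiplier `(2 π i e ξ) ^ r`. -/
noncomputable def fracSymbol (e r ξ : ℝ) : ℂ :=
  (((2 * Real.pi * (e * ξ) : ℝ) : ℂ) * Complex.I) ^ (r : ℂ)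

@[fun_prop]
theorem measurable_fracSymbol (e r : ℝ) : Measurable (fracSymbol e r) := by
  unfold fracSymbol
  fun_prop

theorem norm_fracSymbol {e : ℝ} (he : e = 1 ∨ e = -1) (r ξ : ℝ) :
    ‖fracSymbol e r ξ‖ = |2 * Real.pi * ξ| ^ r := by
  rw [fracSymbol, Complex.norm_cpow_real]
  rcases he with rfl | rfl <;> simp

/-- The imaginary axis avoids the branch cut, so the principal power commutes with conjugation. -/
theorem ofReal_neg_mul_I_cpow (x r : ℝ) :
    (((-x : ℝ) : ℂ) * Complex.I) ^ (r : ℂ) = conj (((x : ℂ) * Complex.I) ^ (r : ℂ)) := by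
  have h : ((x : ℂ) * Complex.I).arg ≠ Real.pi := by
    intro h
    rw [Complex.arg_eq_pi_iff] at h
    simp at h
  have := Complex.conj_cpow ((x : ℂ) * Complex.I) r h
  rw [Complex.conj_ofReal] at this
  rw [← this]
  simp

theorem fracSymbol_neg_left (e r ξ : ℝ) :
    fracSymbol (-e) r ξ = conj (fracSymbol e r ξ) := by
  rw [fracSymbol, fracSymbol, ← ofReal_neg_mul_I_cpow]
  congr 3
  ring

theorem fracSymbol_neg_right (e r ξ : ℝ) :
    fracSymbol e r (-ξ) = conj (fracSymbol e r ξ) := by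
  rw [← fracSymbol_neg_left e r]
  simp [fracSymbol]

/-- The base has argument ±π/2, so the power has argument ±πr/2. Cosine is even, hence neither `e`
nor the sign of ξ matters. -/
theorem re_fracSymbol {e : ℝ} (he : e = 1 ∨ e = -1) (r : ℝ) {ξ : ℝ} (hξ : ξ ≠ 0) :
    (fracSymbol e r ξ).re = |2 * Real.pi * ξ| ^ r * Real.cos (Real.pi / 2 * r) := by
  have pos (x : ℝ) (hx : 0 < x) :
      (((x : ℂ) * Complex.I) ^ (r : ℂ)).re = |x| ^ r * Real.cos (Real.pi / 2 * r) := by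
    rw [Complex.cpow_ofReal_re, Complex.arg_real_mul _ hx, Complex.arg_I]
    simp
  have key (x : ℝ) (hx : x ≠ 0) :
      (((x : ℂ) * Complex.I) ^ (r : ℂ)).re = |x| ^ r * Real.cos (Real.pi / 2 * r) := by
    rcases hx.lt_or_gt with h | h
    · have := pos (-x) (by linarith)
      rwa [ofReal_neg_mul_I_cpow x, Complex.conj_re, abs_neg] at this
    · exact pos x h
  rw [fracSymbol, key]
  · congr 2
    rcases he with rfl | rfl <;> simp
  · rcases he with rfl | rfl <;> simp [hξ, Real.pi_ne_zero]

theorem tendsto_add_ofReal_mul_I_cpow {x : ℝ} (hx : x ≠ 0) (w : ℂ) :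
    Tendsto (fun ε : ℝ => ((ε : ℂ) + (x : ℂ) * Complex.I) ^ w) (𝓝 0)
      (𝓝 (((x : ℂ) * Complex.I) ^ w)) := by
  have h : (x : ℂ) * Complex.I ∈ Complex.slitPlane := by simp [Complex.mem_slitPlane_iff, hx]
  have h2 : Tendsto (fun ε : ℝ => (ε : ℂ) + (x : ℂ) * Complex.I) (𝓝 0)
      (𝓝 ((x : ℂ) * Complex.I)) := by
    have : Continuous fun ε : ℝ => (ε : ℂ) + (x : ℂ) * Complex.I := by fun_prop
    simpa using this.tendsto 0
  exact h2.cpow tendsto_const_nhds h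

/-- |ε + ix| ≥ |x| and the exponent is not positive. The undamped symbol thus dominates all the
damped ones. -/
theorem norm_add_ofReal_mul_I_cpow_le {x : ℝ} (hx : x ≠ 0) (ε : ℝ) {σ : ℝ} (hσ : 0 ≤ σ) :
    ‖((ε : ℂ) + (x : ℂ) * Complex.I) ^ (-(σ : ℂ))‖ ≤ ‖((x : ℂ) * Complex.I) ^ (-(σ : ℂ))‖ := by
  rw [← Complex.ofReal_neg, Complex.norm_cpow_real, Complex.norm_cpow_real]
  refine Real.rpow_le_rpow_of_nonpos (by simpa) ?_ (by linarith)
  have := Complex.abs_im_le_norm ((ε : ℂ) + (x : ℂ) * Complex.I)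
  simpa using this

/-! ### The Plancherel transform of real functions -/

theorem integral_fourier_mul_L2 (F : Lp ℂ 2 (volume : Measure ℝ)) (θ : 𝓢(ℝ, ℂ)) :
    ∫ x, 𝓕 θ x * F x = ∫ x, θ x * (𝓕 F : Lp ℂ 2 (volume : Measure ℝ)) x := by
  have := congrArg (fun T => T θ) (Lp.fourier_toTemperedDistribution_eq F)
  simpa [Lp.toTemperedDistribution_apply] using this

theorem integral_mul_fourierInv_L2 (F : Lp ℂ 2 (volume : Measure ℝ)) (φ : 𝓢(ℝ, ℂ)) :
    ∫ x, φ x * (𝓕⁻ F : Lp ℂ 2 (volume : Measure ℝ)) x = ∫ x, 𝓕⁻ φ x * F x := by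
  simpa using integral_fourier_mul_L2 (𝓕⁻ F) (𝓕⁻ φ)

theorem fourier_ofReal_neg (ψ : ℝ → ℝ) (ξ : ℝ) :
    𝓕 (fun x => (ψ x : ℂ)) (-ξ) = conj (𝓕 (fun x => (ψ x : ℂ)) ξ) := by
  rw [Real.fourier_real_eq_integral_exp_smul, Real.fourier_real_eq_integral_exp_smul,
    ← integral_conj]
  congr 1
  ext x
  simp [← Complex.exp_conj, Complex.conj_ofNat]

/-- A real test function as a complex Schwartz function. -/
noncomputable def testSchwartz {ψ : ℝ → ℝ} (h : ContDiff ℝ ∞ ψ) (hc : HasCompactSupport ψ) :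
    𝓢(ℝ, ℂ) :=
  HasCompactSupport.toSchwartzMap (f := fun x => (ψ x : ℂ))
    (hc.comp_left (g := Complex.ofReal) Complex.ofReal_zero) (Complex.ofRealCLM.contDiff.comp h)

section

variable {ψ : ℝ → ℝ} (h : ContDiff ℝ ∞ ψ) (hc : HasCompactSupport ψ)

@[simp]
theorem testSchwartz_apply (x : ℝ) : testSchwartz h hc x = ψ x := rfl

theorem fourierInv_testSchwartz (ξ : ℝ) :
    𝓕⁻ (testSchwartz h hc) ξ = conj (𝓕 (fun x => (ψ x : ℂ)) ξ) := by
  rw [SchwartzMap.fourierInv_coe, Real.fourierInv_eq_fourier_neg]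
  exact fourier_ofReal_neg ψ ξ

end

/-- Proved weakly: against a real test function, conjugation passes through the integral and ξ ↦ -ξ
matches the two sides. -/
theorem fourierInv_conj_neg {F F' : Lp ℂ 2 (volume : Measure ℝ)}
    (hF : ∀ᵐ ξ : ℝ, F' ξ = conj (F (-ξ))) :
    ∀ᵐ x : ℝ, (𝓕⁻ F' : Lp ℂ 2 (volume : Measure ℝ)) x =
      conj ((𝓕⁻ F : Lp ℂ 2 (volume : Measure ℝ)) x) := by
  have hloc (G : Lp ℂ 2 (volume : Measure ℝ)) : LocallyIntegrable G :=
    (Lp.memLp G).locallyIntegrable (by norm_num)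
  refine ae_eq_of_integral_contDiff_smul_eq (hloc _) ?_ fun φ hφ hφc => ?_
  · exact ((Lp.memLp (𝓕⁻ F : Lp ℂ 2 (volume : Measure ℝ))).star).locallyIntegrable (by norm_num)
  · simp only [Complex.real_smul]
    have h1 := integral_mul_fourierInv_L2 F' (testSchwartz hφ hφc)
    have h2 := integral_mul_fourierInv_L2 F (testSchwartz hφ hφc)
    simp only [testSchwartz_apply, fourierInv_testSchwartz] at h1 h2
    rw [h1]
    have h3 : ∫ x, (φ x : ℂ) * conj ((𝓕⁻ F : Lp ℂ 2 (volume : Measure ℝ)) x) =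
        conj (∫ x, (φ x : ℂ) * (𝓕⁻ F : Lp ℂ 2 (volume : Measure ℝ)) x) := by
      rw [← integral_conj]
      simp
    rw [h3, h2, ← integral_conj, ← integral_neg_eq_self]
    refine integral_congr_ae ?_
    have hF' : ∀ᵐ ξ : ℝ, F' (-ξ) = conj (F (- -ξ)) :=
      (Measure.measurePreserving_neg (volume : Measure ℝ)).quasiMeasurePreserving.ae hF
    filter_upwards [hF'] with ξ hξ
    rw [hξ, fourier_ofReal_neg]
    simp

theorem ofReal_compLp_ae (u : Lp ℝ 2 (volume : Measure ℝ)) :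
    ∀ᵐ x, (Complex.ofRealCLM.compLp u : Lp ℂ 2 (volume : Measure ℝ)) x = (u x : ℂ) := by
  filter_upwards [Complex.ofRealCLM.coeFn_compLp u] with x hx
  simpa using hx

theorem fourierInv_plancherel (u : Lp ℝ 2 (volume : Measure ℝ)) :
    𝓕⁻ (plancherel u) = Complex.ofRealCLM.compLp u :=
  FourierTransform.fourierInv_fourier_eq _

theorem plancherel_injective {u v : Lp ℝ 2 (volume : Measure ℝ)}
    (h : plancherel u = plancherel v) : u = v := by
  have h' := congrArg (𝓕⁻ ·) h
  simp only [fourierInv_plancherel] at h'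
  refine Lp.ext ?_
  filter_upwards [ofReal_compLp_ae u, ofReal_compLp_ae v] with x hu hv
  rw [h', hv] at hu
  exact_mod_cast hu.symm

/-- The reflected conjugate of û has inverse transform ū = u, so it equals û. -/
theorem plancherel_neg (u : Lp ℝ 2 (volume : Measure ℝ)) :
    ∀ᵐ ξ : ℝ, plancherel u (-ξ) = conj (plancherel u ξ) := by
  have hmem : MemLp (fun ξ => conj (plancherel u (-ξ))) 2 (volume : Measure ℝ) :=
    ((Lp.memLp (plancherel u)).comp_measurePreserving
      (Measure.measurePreserving_neg (volume : Measure ℝ))).star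
  have h1 : hmem.toLp = plancherel u := by
    have : 𝓕⁻ hmem.toLp = 𝓕⁻ (plancherel u) := by
      refine Lp.ext ?_
      filter_upwards [fourierInv_conj_neg hmem.coeFn_toLp, ofReal_compLp_ae u] with x hx hu
      rw [hx, fourierInv_plancherel, hu, Complex.conj_ofReal]
    simpa using congrArg (𝓕 ·) this
  filter_upwards [hmem.coeFn_toLp] with ξ hξ
  rw [h1] at hξ
  rw [hξ, Complex.conj_conj]

/-- Supplies the real functions that are constructed by prescribing their transforms. -/
theorem exists_plancherel_eq {F : Lp ℂ 2 (volume : Measure ℝ)}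
    (hF : ∀ᵐ ξ : ℝ, F ξ = conj (F (-ξ))) :
    ∃ u : Lp ℝ 2 (volume : Measure ℝ), plancherel u = F := by
  refine ⟨Complex.reCLM.compLp (𝓕⁻ F : Lp ℂ 2 (volume : Measure ℝ)), ?_⟩
  suffices Complex.ofRealCLM.compLp (Complex.reCLM.compLp (𝓕⁻ F : Lp ℂ 2 (volume : Measure ℝ))) =
      𝓕⁻ F by
    rw [plancherel, this, FourierTransform.fourier_fourierInv_eq]
  refine Lp.ext ?_
  filter_upwards [ofReal_compLp_ae (Complex.reCLM.compLp (𝓕⁻ F : Lp ℂ 2 (volume : Measure ℝ))),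
    Complex.reCLM.coeFn_compLp (𝓕⁻ F : Lp ℂ 2 (volume : Measure ℝ)),
    fourierInv_conj_neg hF] with x h1 h2 h3
  rw [h1, h2]
  exact Complex.conj_eq_iff_re.1 h3.symm

theorem integral_mul_eq_plancherel (u v : Lp ℝ 2 (volume : Measure ℝ)) :
    ((∫ x, u x * v x : ℝ) : ℂ) = ∫ ξ, plancherel u ξ * conj (plancherel v ξ) := by
  have h := Lp.inner_fourier_eq (Complex.ofRealCLM.compLp v : Lp ℂ 2 (volume : Measure ℝ))
    (Complex.ofRealCLM.compLp u)
  rw [L2.inner_def, L2.inner_def] at h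
  calc ((∫ x, u x * v x : ℝ) : ℂ) = ∫ x, ((u x * v x : ℝ) : ℂ) := integral_ofReal.symm
    _ = _ := by
      refine Eq.trans (integral_congr_ae ?_) h.symm
      filter_upwards [ofReal_compLp_ae u, ofReal_compLp_ae v] with x hu hv
      simp [hu, hv]
    _ = _ := by simp [plancherel]

theorem integrable_plancherel_mul_conj {F G : ℝ → ℂ} (hF : MemLp F 2) (hG : MemLp G 2) :
    Integrable fun ξ => F ξ * conj (G ξ) :=
  hF.integrable_mul hG.star

theorem plancherel_toLp_testSchwartz {ψ : ℝ → ℝ} (h : ContDiff ℝ ∞ ψ) (hc : HasCompactSupport ψ)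
    (hm : MemLp ψ 2) :
    plancherel hm.toLp =ᵐ[volume] 𝓕 (fun x => (ψ x : ℂ)) := by
  have : Complex.ofRealCLM.compLp (hm.toLp) = (testSchwartz h hc).toLp 2 := by
    refine Lp.ext ?_
    filter_upwards [ofReal_compLp_ae hm.toLp, hm.coeFn_toLp,
      (testSchwartz h hc).coeFn_toLp 2 volume] with x h1 h2 h3
    rw [h1, h2, h3, testSchwartz_apply]
  rw [plancherel, this, SchwartzMap.toLp_fourier_eq]
  exact (𝓕 (testSchwartz h hc)).coeFn_toLp 2 volume

/-! ### The undamped kernel convolved with a test function -/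

theorem ofReal_convolution (k ψ : ℝ → ℝ) (x : ℝ) :
    (((k ⋆[ContinuousLinearMap.mul ℝ ℝ, volume] ψ) x : ℝ) : ℂ) =
      ((fun t => (k t : ℂ)) ⋆[ContinuousLinearMap.mul ℂ ℂ, volume] (fun t => (ψ t : ℂ))) x := by
  rw [convolution_mul, convolution_mul, ← integral_complex_ofReal]
  simp

theorem integral_fourier_mul_eq {f g : ℝ → ℂ} (hf : Integrable f) (hg : Integrable g) :
    ∫ ξ, 𝓕 f ξ * g ξ = ∫ x, f x * 𝓕 g x := by
  simpa using! VectorFourier.integral_fourierIntegral_smul_eq_flip (L := innerₗ ℝ)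
    Real.continuous_fourierChar continuous_inner hf hg

section

variable {ψ : ℝ → ℝ} (h : ContDiff ℝ ∞ ψ) (hc : HasCompactSupport ψ) {e : ℝ}
  (he : e = 1 ∨ e = -1) {σ : ℝ} (hσ : 0 < σ)

include h hc he hσ

/-- Write φ as the transform of its inverse transform and apply the multiplication formula and the
convolution theorem, both available since the damped kernel is integrable. -/
theorem integral_mul_convolution_rlKernel {φ : ℝ → ℝ} (hφ : ContDiff ℝ ∞ φ)
    (hφc : HasCompactSupport φ) {ε : ℝ} (hε : 0 < ε) :
    ((∫ x, φ x * (rlKernel e σ ε ⋆[ContinuousLinearMap.mul ℝ ℝ, volume] ψ) x : ℝ) : ℂ) =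
      ∫ ξ, 𝓕⁻ (testSchwartz hφ hφc) ξ *
        ((ε + ((2 * Real.pi * (e * ξ) : ℝ) : ℂ) * Complex.I) ^ (-(σ : ℂ)) *
          𝓕 (fun x => (ψ x : ℂ)) ξ) := by
  have hk : Integrable fun t => (rlKernel e σ ε t : ℂ) := (integrable_rlKernel he hσ hε).ofReal
  have hψ : Integrable fun t => (ψ t : ℂ) := (testSchwartz h hc).integrable
  have h1 := integral_fourier_mul_eq (𝓕⁻ (testSchwartz hφ hφc)).integrable
    (hk.integrable_convolution (ContinuousLinearMap.mul ℂ ℂ) hψ)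
  rw [← SchwartzMap.fourier_coe, FourierTransform.fourier_fourierInv_eq] at h1
  simp_rw [Real.fourier_mul_convolution_eq hk hψ, fourier_rlKernel he hσ hε,
    ← ofReal_convolution] at h1
  rw [← h1, ← integral_complex_ofReal]
  simp

theorem tendsto_integral_mul_convolution_rlKernel {φ : ℝ → ℝ} (hφ : Continuous φ)
    (hφc : HasCompactSupport φ) :
    Tendsto (fun ε => ∫ x, φ x * (rlKernel e σ ε ⋆[ContinuousLinearMap.mul ℝ ℝ, volume] ψ) x)
      (𝓝[>] 0)
      (𝓝 (∫ x, φ x * (rlKernel e σ 0 ⋆[ContinuousLinearMap.mul ℝ ℝ, volume] ψ) x)) := by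
  have hk := locallyIntegrable_rlKernel he hσ
  have hex (x : ℝ) := hc.norm.convolutionExists_right (ContinuousLinearMap.mul ℝ ℝ) hk
    h.continuous.norm x
  have hcont : Continuous (rlKernel e σ 0 ⋆[ContinuousLinearMap.mul ℝ ℝ, volume] (‖ψ ·‖)) :=
    hc.norm.continuous_convolution_right _ hk h.continuous.norm
  have hle (ε : ℝ) (hε : 0 < ε) (x t : ℝ) :
      ‖rlKernel e σ ε t * ψ (x - t)‖ ≤ rlKernel e σ 0 t * ‖ψ (x - t)‖ := by
    rw [norm_mul, Real.norm_of_nonneg (rlKernel_nonneg e hσ ε t)]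
    gcongr
    exact rlKernel_le e hσ hε.le t
  refine tendsto_integral_filter_of_dominated_convergence
    (fun x => ‖φ x‖ * (rlKernel e σ 0 ⋆[ContinuousLinearMap.mul ℝ ℝ, volume] (‖ψ ·‖)) x) ?_ ?_ ?_ ?_
  · filter_upwards [self_mem_nhdsWithin] with ε hε
    exact (hφ.mul (hc.continuous_convolution_right _
      (integrable_rlKernel he hσ hε).locallyIntegrable h.continuous)).aestronglyMeasurable
  · filter_upwards [self_mem_nhdsWithin] with ε hε
    refine .of_forall fun x => ?_
    rw [norm_mul]
    gcongr
    rw [convolution_mul, convolution_mul]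
    exact norm_integral_le_of_norm_le (hex x) (.of_forall fun t => hle ε hε x t)
  · exact (hφ.norm.mul hcont).integrable_of_hasCompactSupport hφc.norm.mul_right
  · refine .of_forall fun x => Tendsto.const_mul _ ?_
    simp_rw [convolution_mul]
    refine tendsto_integral_filter_of_dominated_convergence
      (fun t => rlKernel e σ 0 t * ‖ψ (x - t)‖) ?_ ?_ (hex x) ?_
    · refine .of_forall fun ε => ?_
      have := h.continuous.measurable
      exact Measurable.aestronglyMeasurable (by fun_prop)
    · filter_upwards [self_mem_nhdsWithin] with ε hε
      exact .of_forall fun t => hle ε hε x t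
    · exact .of_forall fun t => ((tendsto_rlKernel e σ t).mono_left nhdsWithin_le_nhds).mul_const _

/-- Let ε → 0 in the damped identity on both sides. Square integrability of the product is assumed
rather than σ < 1/2, because derivatives need the exponent 1 - s > 1/2 applied to ψ'. -/
theorem plancherel_convolution_rlKernel
    (hL : MemLp (fun ξ => fracSymbol e (-σ) ξ * 𝓕 (fun x => (ψ x : ℂ)) ξ) 2) :
    ∃ hm : MemLp (rlKernel e σ 0 ⋆[ContinuousLinearMap.mul ℝ ℝ, volume] ψ) 2,
      plancherel hm.toLp =ᵐ[volume]
        fun ξ => fracSymbol e (-σ) ξ * 𝓕 (fun x => (ψ x : ℂ)) ξ := by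
  set g := rlKernel e σ 0 ⋆[ContinuousLinearMap.mul ℝ ℝ, volume] ψ
  have hgc : Continuous g :=
    hc.continuous_convolution_right _ (locallyIntegrable_rlKernel he hσ) h.continuous
  set X : Lp ℂ 2 (volume : Measure ℝ) := 𝓕⁻ hL.toLp with hX
  have key : ∀ᵐ x, X x = (g x : ℂ) := by
    refine ae_eq_of_integral_contDiff_smul_eq ((Lp.memLp X).locallyIntegrable (by norm_num))
      (Complex.continuous_ofReal.comp hgc).locallyIntegrable fun φ hφ hφc => ?_
    simp only [Complex.real_smul]
    have h1 := integral_mul_fourierInv_L2 hL.toLp (testSchwartz hφ hφc)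
    simp only [testSchwartz_apply] at h1
    rw [hX, h1]
    have h2 : ∫ x, (φ x : ℂ) * (g x : ℂ) = ((∫ x, φ x * g x : ℝ) : ℂ) := by
      rw [← integral_complex_ofReal]
      simp
    rw [h2]
    have h3 := (Complex.continuous_ofReal.tendsto _).comp
      (tendsto_integral_mul_convolution_rlKernel h hc he hσ hφ.continuous hφc)
    refine tendsto_nhds_unique ?_ h3
    have h4 : Tendsto (fun ε : ℝ => ∫ ξ, 𝓕⁻ (testSchwartz hφ hφc) ξ *
        ((ε + ((2 * Real.pi * (e * ξ) : ℝ) : ℂ) * Complex.I) ^ (-(σ : ℂ)) *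
          𝓕 (fun x => (ψ x : ℂ)) ξ)) (𝓝[>] 0)
        (𝓝 (∫ ξ, 𝓕⁻ (testSchwartz hφ hφc) ξ * (hL.toLp : Lp ℂ 2 (volume : Measure ℝ)) ξ)) := by
      -- At ξ = 0 the limiting power takes the default value 0, so domination and convergence both
      -- fail there.
      have hne : ∀ᵐ ξ : ℝ, 2 * Real.pi * (e * ξ) ≠ 0 := by
        filter_upwards [compl_mem_ae_iff.2 (measure_singleton (μ := volume) (0 : ℝ))] with ξ hξ
        have : e ≠ 0 := by rcases he with rfl | rfl <;> norm_num
        exact mul_ne_zero (by positivity) (mul_ne_zero this hξ)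
      refine tendsto_integral_filter_of_dominated_convergence
        (fun ξ => ‖𝓕⁻ (testSchwartz hφ hφc) ξ *
          (fracSymbol e (-σ) ξ * 𝓕 (fun x => (ψ x : ℂ)) ξ)‖) ?_ ?_ ?_ ?_
      · refine .of_forall fun ε => ?_
        refine (𝓕⁻ (testSchwartz hφ hφc)).continuous.aestronglyMeasurable.mul
          (AEStronglyMeasurable.mul ?_ (𝓕 (testSchwartz h hc)).continuous.aestronglyMeasurable)
        exact Measurable.aestronglyMeasurable (by fun_prop)
      · refine .of_forall fun ε => ?_
        filter_upwards [hne] with ξ hξ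
        rw [norm_mul, norm_mul, norm_mul, norm_mul]
        gcongr
        simpa [fracSymbol] using norm_add_ofReal_mul_I_cpow_le hξ ε hσ.le
      · exact (MemLp.integrable_mul ((𝓕⁻ (testSchwartz hφ hφc)).memLp 2) hL).norm
      · filter_upwards [hne, hL.coeFn_toLp] with ξ hξ hξ'
        rw [hξ']
        refine (Tendsto.mul_const _ ?_).const_mul _
        have := (tendsto_add_ofReal_mul_I_cpow hξ (-(σ : ℂ))).mono_left
          (nhdsWithin_le_nhds (s := Ioi 0))
        simpa [fracSymbol] using this
    refine h4.congr' ?_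
    filter_upwards [self_mem_nhdsWithin] with ε hε
    exact (integral_mul_convolution_rlKernel h hc he hσ hφ hφc hε).symm
  have hm : MemLp g 2 := by
    have : MemLp (fun x => (g x : ℂ)) 2 := (memLp_congr_ae key).1 (Lp.memLp X)
    simpa using this.re
  refine ⟨hm, ?_⟩
  have : Complex.ofRealCLM.compLp hm.toLp = X := by
    refine Lp.ext ?_
    filter_upwards [ofReal_compLp_ae hm.toLp, hm.coeFn_toLp, key] with x h1 h2 h3
    rw [h1, h2, h3]
  rw [plancherel, this, hX, FourierTransform.fourier_fourierInv_eq]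
  exact hL.coeFn_toLp

end

/-! ### Test functions and square integrability of their multiplied transforms -/

theorem exists_testFunction_eq_one (R : ℝ) : ∃ χ : ℝ → ℝ, ContDiff ℝ ∞ χ ∧ HasCompactSupport χ ∧
    (∀ x, 0 ≤ χ x) ∧ ∀ x, |x| ≤ R → χ x = 1 := by
  let f : ContDiffBump (0 : ℝ) := ⟨|R| + 1, |R| + 2, by positivity, by linarith⟩
  refine ⟨f, f.contDiff, f.hasCompactSupport, fun x => f.nonneg, fun x hx => ?_⟩
  refine f.one_of_mem_closedBall ?_
  rw [mem_closedBall_zero_iff, Real.norm_eq_abs]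
  exact hx.trans ((le_abs_self R).trans (by simp [f]))

theorem exists_testFunction_ge {ψ : ℝ → ℝ} (h : Continuous ψ) (hc : HasCompactSupport ψ) :
    ∃ χ : ℝ → ℝ, ContDiff ℝ ∞ χ ∧ HasCompactSupport χ ∧ ∀ x, |ψ x| ≤ χ x := by
  obtain ⟨C, hC⟩ := hc.exists_bound_of_continuous h
  obtain ⟨R, hR⟩ := hc.isCompact.isBounded.subset_closedBall 0
  obtain ⟨χ, h1, h2, h3, h4⟩ := exists_testFunction_eq_one R
  refine ⟨fun x => C * χ x, contDiff_const.mul h1, h2.mul_left, fun x => ?_⟩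
  by_cases hx : x ∈ tsupport ψ
  · simpa [h4 x (by simpa using hR hx)] using hC x
  · rw [image_eq_zero_of_notMem_tsupport hx, abs_zero]
    exact mul_nonneg ((norm_nonneg _).trans (hC x)) (h3 x)

/-- Up to the Gamma factor, this is the left kernel plus the right kernel of order r + 1. -/
theorem locallyIntegrable_abs_rpow {r : ℝ} (hr : -1 < r) :
    LocallyIntegrable fun x : ℝ => |x| ^ r := by
  have hσ : 0 < r + 1 := by linarith
  have h := ((locallyIntegrable_rlKernel (Or.inl rfl) hσ).add
    (locallyIntegrable_rlKernel (Or.inr rfl) hσ)).smul (Real.Gamma (r + 1))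
  refine h.mono (Measurable.aestronglyMeasurable (by fun_prop)) ?_
  filter_upwards [compl_mem_ae_iff.2 (measure_singleton (μ := volume) (0 : ℝ))] with x hx
  have hx : x ≠ 0 := hx
  have hΓ := (Real.Gamma_pos_of_pos hσ).ne'
  refine (congrArg norm ?_).le
  rcases hx.lt_or_gt with h | h
  · simp [rlKernel, h, h.le, abs_of_neg h, hΓ]
  · simp [rlKernel, h, h.le, abs_of_pos h, hΓ]

section

variable {ψ : ℝ → ℝ} (h : ContDiff ℝ ∞ ψ) (hc : HasCompactSupport ψ)

include h hc

theorem memLp_testFunction : MemLp ψ 2 := h.continuous.memLp_of_hasCompactSupport hc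

theorem memLp_fourier_testFunction : MemLp (𝓕 (fun x => (ψ x : ℂ)) : ℝ → ℂ) 2 :=
  (𝓕 (testSchwartz h hc)).memLp 2 volume

theorem fourier_deriv_testFunction (ξ : ℝ) : 𝓕 (fun x => ((deriv ψ x : ℝ) : ℂ)) ξ =
    ((2 * Real.pi * ξ : ℝ) : ℂ) * Complex.I * 𝓕 (fun x => (ψ x : ℂ)) ξ := by
  have hd (x : ℝ) : HasDerivAt (fun x => (ψ x : ℂ)) ((deriv ψ x : ℝ) : ℂ) x :=
    ((h.differentiable (by simp)).differentiableAt.hasDerivAt).ofReal_comp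
  have hd' : deriv (fun x => (ψ x : ℂ)) = fun x => ((deriv ψ x : ℝ) : ℂ) :=
    funext fun x => (hd x).deriv
  have h1 := Real.fourier_deriv (testSchwartz h hc).integrable (testSchwartz h hc).differentiable
    (SchwartzMap.derivCLM ℝ ℂ (testSchwartz h hc)).integrable
  have h2 := congrFun h1 ξ
  change 𝓕 (deriv (fun x => (ψ x : ℂ))) ξ = _ at h2
  rw [hd'] at h2
  rw [h2, smul_eq_mul]
  push_cast
  change _ * 𝓕 (fun x => (ψ x : ℂ)) ξ = _
  ring

variable {e : ℝ} (he : e = 1 ∨ e = -1)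

include he

/-- Near the origin |ξ|^(-2σ) is integrable because 2σ < 1; for |ξ| > 1 the symbol is at most 1. -/
theorem memLp_fracSymbol_neg_mul_fourier {σ : ℝ} (hσ : 0 < σ) (hσ' : σ < 1 / 2) :
    MemLp (fun ξ => fracSymbol e (-σ) ξ * 𝓕 (fun x => (ψ x : ℂ)) ξ) 2 := by
  have hm : AEStronglyMeasurable (fun ξ => fracSymbol e (-σ) ξ * 𝓕 (fun x => (ψ x : ℂ)) ξ) :=
    (measurable_fracSymbol e (-σ)).aestronglyMeasurable.mul
      (memLp_fourier_testFunction h hc).aestronglyMeasurable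
  rw [memLp_two_iff_integrable_sq_norm hm]
  have h1 := (memLp_fourier_testFunction h hc).integrable_norm_pow (by norm_num)
  have h2 : IntegrableOn (fun ξ : ℝ => (|2 * Real.pi| ^ (-(2 * σ)) * |ξ| ^ (-(2 * σ))) *
      ‖𝓕 (fun x => (ψ x : ℂ)) ξ‖ ^ 2) (Icc (-1) 1) := by
    refine IntegrableOn.mul_continuousOn ?_ ?_ isCompact_Icc
    · exact ((locallyIntegrable_abs_rpow (by linarith)).integrableOn_isCompact
        isCompact_Icc).const_mul _
    · exact ((𝓕 (testSchwartz h hc)).continuous.norm.pow 2).continuousOn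
  rw [← integrable_indicator_iff measurableSet_Icc] at h2
  refine (h2.add h1).mono' (hm.norm.pow 2) (.of_forall fun ξ => ?_)
  have hp : (|2 * Real.pi * ξ| ^ (-σ)) ^ 2 = |2 * Real.pi| ^ (-(2 * σ)) * |ξ| ^ (-(2 * σ)) := by
    rw [← Real.mul_rpow (abs_nonneg _) (abs_nonneg _), ← abs_mul, ← Real.rpow_natCast,
      ← Real.rpow_mul (abs_nonneg _)]
    congr 1
    push_cast
    ring
  rw [norm_pow, norm_norm, norm_mul, norm_fracSymbol he, mul_pow, hp, Pi.add_apply]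
  by_cases hξ : ξ ∈ Icc (-1 : ℝ) 1
  · rw [indicator_of_mem hξ]
    simp only [le_add_iff_nonneg_right]
    positivity
  · rw [indicator_of_notMem hξ, zero_add, ← hp]
    have h1 : 1 < |ξ| := by
      rw [← not_le, abs_le]
      exact hξ
    have h2 : 1 ≤ |2 * Real.pi * ξ| := by
      rw [abs_mul, abs_of_pos (by positivity)]
      nlinarith [Real.pi_gt_three]
    have h3 : |2 * Real.pi * ξ| ^ (-σ) ≤ 1 := Real.rpow_le_one_of_one_le_of_nonpos h2 (by linarith)
    refine mul_le_of_le_one_left (by positivity) (pow_le_one₀ (by positivity) h3)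

/-- ρ^s ≤ 1 + ρ for 0 < s < 1, and ρ|ψ̂| is the modulus of the transform of ψ'. -/
theorem memLp_fracSymbol_mul_fourier {s : ℝ} (hs : 0 < s) (hs' : s < 1) :
    MemLp (fun ξ => fracSymbol e s ξ * 𝓕 (fun x => (ψ x : ℂ)) ξ) 2 := by
  have hd : ContDiff ℝ ∞ (deriv ψ) := (contDiff_infty_iff_deriv.1 h).2
  have h1 := (memLp_fourier_testFunction h hc).norm.add (memLp_fourier_testFunction hd hc.deriv).norm
  refine h1.mono ((measurable_fracSymbol e s).aestronglyMeasurable.mul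
      (memLp_fourier_testFunction h hc).aestronglyMeasurable) (.of_forall fun ξ => ?_)
  simp only [Pi.add_apply, fourier_deriv_testFunction h hc, norm_mul, norm_fracSymbol he,
    Complex.norm_real, Complex.norm_I, Real.norm_eq_abs ]
  rw [abs_of_nonneg (a := _ + _) (by positivity), mul_one, ← one_add_mul]
  gcongr
  rcases le_total |2 * Real.pi * ξ| 1 with h | h
  · exact (Real.rpow_le_one (abs_nonneg _) h hs.le).trans (by simp)
  · exact (Real.rpow_le_self_of_one_le h hs'.le).trans (by simp)

/-- Absorbing the sign into ψ' gives it the multiplier z = 2πieξ, and z^(-(1-s)) z = z^s. -/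
theorem plancherel_rlDeriv {s : ℝ} (hs : 0 < s) (hs' : s < 1) :
    ∃ hm : MemLp (fun x => e *
        (rlKernel e (1 - s) 0 ⋆[ContinuousLinearMap.mul ℝ ℝ, volume] deriv ψ) x) 2,
      plancherel hm.toLp =ᵐ[volume] fun ξ => fracSymbol e s ξ * 𝓕 (fun x => (ψ x : ℂ)) ξ := by
  have hd : ContDiff ℝ ∞ (fun x => e * ψ x) := contDiff_const.mul h
  have hdc : HasCompactSupport (fun x => e * ψ x) := hc.mul_left
  have hF (ξ : ℝ) : 𝓕 (fun x => ((deriv (fun x => e * ψ x) x : ℝ) : ℂ)) ξ =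
      (((2 * Real.pi * (e * ξ) : ℝ) : ℂ) * Complex.I) * 𝓕 (fun x => (ψ x : ℂ)) ξ := by
    rw [fourier_deriv_testFunction hd hdc]
    have : (fun x => ((e * ψ x : ℝ) : ℂ)) = fun x => (e : ℂ) • (ψ x : ℂ) := by
      ext
      simp
    rw [this, Real.fourier_real_eq_integral_exp_smul, Real.fourier_real_eq_integral_exp_smul]
    simp_rw [smul_comm _ (e : ℂ)]
    rw [integral_smul]
    push_cast
    simp only [smul_eq_mul]
    ring
  have hmul : ∀ᵐ ξ : ℝ, fracSymbol e (-(1 - s)) ξ *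
      𝓕 (fun x => ((deriv (fun x => e * ψ x) x : ℝ) : ℂ)) ξ =
      fracSymbol e s ξ * 𝓕 (fun x => (ψ x : ℂ)) ξ := by
    filter_upwards [compl_mem_ae_iff.2 (measure_singleton (μ := volume) (0 : ℝ))] with ξ hξ
    have hξ : ξ ≠ 0 := hξ
    have he' : e ≠ 0 := by rcases he with rfl | rfl <;> norm_num
    have hne : (((2 * Real.pi * (e * ξ) : ℝ) : ℂ) * Complex.I) ≠ 0 := by
      refine mul_ne_zero ?_ Complex.I_ne_zero
      exact_mod_cast mul_ne_zero (by positivity) (mul_ne_zero he' hξ)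
    rw [hF, ← mul_assoc]
    congr 1
    rw [fracSymbol, fracSymbol]
    nth_rewrite 2 [← Complex.cpow_one (((2 * Real.pi * (e * ξ) : ℝ) : ℂ) * Complex.I)]
    rw [← Complex.cpow_add _ _ hne]
    congr 1
    push_cast
    ring
  have hL := (memLp_congr_ae hmul).2 (memLp_fracSymbol_mul_fourier h hc he hs hs')
  obtain ⟨hm, hp⟩ := plancherel_convolution_rlKernel (contDiff_infty_iff_deriv.1 hd).2 hdc.deriv he
    (show 0 < 1 - s by linarith) hL
  have heq : (rlKernel e (1 - s) 0 ⋆[ContinuousLinearMap.mul ℝ ℝ, volume]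
      deriv (fun x => e * ψ x)) = fun x => e *
        (rlKernel e (1 - s) 0 ⋆[ContinuousLinearMap.mul ℝ ℝ, volume] deriv ψ) x := by
    have : deriv (fun x => e * ψ x) = e • deriv ψ := by
      ext x
      simp
    rw [this, convolution_smul]
    rfl
  simp only [heq] at hm hp
  exact ⟨hm, hp.trans hmul⟩

end

/-! ### Fractional integrals of square integrable functions, by duality -/

theorem integral_mul_eq_of_plancherel {g : ℝ → ℝ} (hm : MemLp g 2) {χ : ℝ → ℂ}
    (hχ : plancherel hm.toLp =ᵐ[volume] χ) (u : Lp ℝ 2 (volume : Measure ℝ)) :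
    Integrable (fun x => u x * g x) ∧
      ((∫ x, u x * g x : ℝ) : ℂ) = ∫ ξ, plancherel u ξ * conj (χ ξ) := by
  refine ⟨(Lp.memLp u).integrable_mul hm, ?_⟩
  have := integral_mul_eq_plancherel u hm.toLp
  have h1 : ∫ x, u x * (hm.toLp : Lp ℝ 2 (volume : Measure ℝ)) x = ∫ x, u x * g x := by
    refine integral_congr_ae ?_
    filter_upwards [hm.coeFn_toLp] with x hx
    rw [hx]
  rw [h1] at this
  rw [this]
  refine integral_congr_ae ?_
  filter_upwards [hχ] with ξ hξ
  rw [hξ]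

section

variable {e : ℝ} (he : e = 1 ∨ e = -1) {σ : ℝ} (hσ : 0 < σ) (hσ' : σ < 1 / 2)
  {u : ℝ → ℝ} (hu : MemLp u 2)

include he hσ hσ' hu

/-- By Tonelli: integrating |ψ| against the kernel in x gives at most the reversed kernel convolved
with a smooth χ ≥ |ψ|. That is in L², hence integrable against u. -/
theorem integrable_prod_mul_rlKernel_mul {ψ : ℝ → ℝ} (h : Continuous ψ)
    (hc : HasCompactSupport ψ) :
    Integrable (fun p : ℝ × ℝ => ψ p.1 * (rlKernel e σ 0 (p.1 - p.2) * u p.2))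
      (volume.prod volume) := by
  have he' : -e = 1 ∨ -e = -1 := by rcases he with rfl | rfl <;> simp
  have hk := locallyIntegrable_rlKernel he' hσ
  have hψ := h.measurable
  have hm : AEStronglyMeasurable
      (fun p : ℝ × ℝ => ψ p.1 * (rlKernel e σ 0 (p.1 - p.2) * u p.2)) (volume.prod volume) := by
    refine AEStronglyMeasurable.mul (Measurable.aestronglyMeasurable (by fun_prop)) ?_
    exact AEStronglyMeasurable.mul (Measurable.aestronglyMeasurable (by fun_prop))
      hu.aestronglyMeasurable.comp_snd
  have hker (x y : ℝ) : rlKernel e σ 0 (x - y) = rlKernel (-e) σ 0 (y - x) := by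
    rw [← rlKernel_neg, neg_sub]
  obtain ⟨χ, hχ, hχc, hχψ⟩ := exists_testFunction_ge h hc
  obtain ⟨hm2, -⟩ := plancherel_convolution_rlKernel hχ hχc he' hσ
    (memLp_fracSymbol_neg_mul_fourier hχ hχc he' hσ hσ')
  rw [integrable_prod_iff' hm]
  constructor
  · refine .of_forall fun y => ?_
    have := (hc.convolutionExists_right (ContinuousLinearMap.mul ℝ ℝ) hk h y).integrable_swap
    refine (this.mul_const (u y)).congr (.of_forall fun x => ?_)
    simp only [ContinuousLinearMap.mul_apply', hker x y]
    ring
  · refine (hu.integrable_mul hm2).norm.mono' hm.norm.prod_swap.integral_prod_right' (.of_forall fun y => ?_)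
    have h1 := (hχc.convolutionExists_right (ContinuousLinearMap.mul ℝ ℝ) hk
      hχ.continuous y).integrable_swap
    rw [Pi.mul_apply, norm_mul, Real.norm_of_nonneg (integral_nonneg fun x => norm_nonneg _),
      convolution_mul_swap]
    refine le_trans ?_ (mul_le_mul_of_nonneg_left (Real.le_norm_self _) (norm_nonneg _))
    rw [← integral_const_mul]
    refine integral_mono_of_nonneg (.of_forall fun x => norm_nonneg _) (h1.const_mul _)
      (.of_forall fun x => ?_)
    simp only [hker x y, norm_mul,
      Real.norm_of_nonneg (rlKernel_nonneg (-e) hσ 0 (y - x))]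
    rw [mul_comm, mul_comm _ ‖u y‖, mul_assoc]
    have := rlKernel_nonneg (-e) hσ 0 (y - x)
    have := hχψ x
    gcongr
    exact this

/-- Fubini with a cutoff equal to 1 on [-n, n] settles almost every x there; then n exhausts the
line. -/
theorem ae_integrable_rlKernel_mul :
    ∀ᵐ x : ℝ, Integrable fun y => rlKernel e σ 0 (x - y) * u y := by
  have key (n : ℕ) : ∀ᵐ x : ℝ, |x| ≤ n → Integrable fun y => rlKernel e σ 0 (x - y) * u y := by
    obtain ⟨χ, h1, h2, -, h3⟩ := exists_testFunction_eq_one n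
    filter_upwards [(integrable_prod_mul_rlKernel_mul he hσ hσ' hu h1.continuous h2).prod_right_ae]
      with x hx hxn
    simpa [h3 x hxn] using hx
  filter_upwards [ae_all_iff.2 key] with x hx
  obtain ⟨n, hn⟩ := exists_nat_ge |x|
  exact hx n hn

theorem locallyIntegrable_rlKernel_convolution :
    LocallyIntegrable (rlKernel e σ 0 ⋆[ContinuousLinearMap.mul ℝ ℝ, volume] u) := by
  rw [locallyIntegrable_iff]
  intro k hk
  obtain ⟨R, hR⟩ := hk.isBounded.subset_closedBall 0
  obtain ⟨χ, h1, h2, -, h3⟩ := exists_testFunction_eq_one R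
  have := (integrable_prod_mul_rlKernel_mul he hσ hσ' hu h1.continuous h2).integral_prod_left
  refine (this.integrableOn (s := k)).congr_fun (fun x hx => ?_) hk.measurableSet
  simp only [h3 x (by simpa using hR hx), one_mul]
  rw [convolution_mul_swap]

theorem integral_rlKernel_convolution_mul {ψ : ℝ → ℝ} (h : Continuous ψ)
    (hc : HasCompactSupport ψ) :
    ∫ x, (rlKernel e σ 0 ⋆[ContinuousLinearMap.mul ℝ ℝ, volume] u) x * ψ x =
      ∫ x, u x * (rlKernel (-e) σ 0 ⋆[ContinuousLinearMap.mul ℝ ℝ, volume] ψ) x := by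
  have := integral_integral_swap (f := fun x y => ψ x * (rlKernel e σ 0 (x - y) * u y))
    (integrable_prod_mul_rlKernel_mul he hσ hσ' hu h hc)
  simp only [convolution_mul_swap, ← integral_const_mul, ← integral_mul_const]
  simp only [mul_comm (ψ _)] at this
  rw [this]
  congr 1
  ext y
  congr 1
  ext x
  rw [← rlKernel_neg, neg_sub]
  ring

end

/-! ### Transforms of test functions separate functions -/

theorem ae_eq_zero_of_fourier_eq_zero {g : ℝ → ℂ} (hg : Integrable g) (h : ∀ ξ, 𝓕 g ξ = 0) :
    g =ᵐ[volume] 0 := by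
  refine ae_eq_zero_of_integral_contDiff_smul_eq_zero hg.locallyIntegrable fun φ hφ hφc => ?_
  have := integral_fourier_mul_eq (𝓕⁻ (testSchwartz hφ hφc)).integrable hg
  rw [← SchwartzMap.fourier_coe, FourierTransform.fourier_fourierInv_eq] at this
  simpa [h] using this

theorem fourier_comp_add_right (f : ℝ → ℂ) (a ξ : ℝ) :
    𝓕 (fun x => f (x + a)) ξ = Complex.exp (((2 * Real.pi * a * ξ : ℝ) : ℂ) * Complex.I) *
      𝓕 f ξ := by
  rw [Real.fourier_real_eq_integral_exp_smul, Real.fourier_real_eq_integral_exp_smul,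
    ← integral_add_right_eq_self (μ := volume)
      (fun v : ℝ => Complex.exp (↑(-2 * Real.pi * v * ξ) * Complex.I) • f v) a,
    ← integral_const_mul]
  congr 1
  ext x
  simp only [smul_eq_mul]
  rw [← mul_assoc, ← Complex.exp_add]
  congr 2
  push_cast
  ring

theorem exists_testFunction_supported {δ : ℝ} (hδ : 0 < δ) : ∃ f : ℝ → ℝ, ContDiff ℝ ∞ f ∧
    HasCompactSupport f ∧ (∀ x, 0 ≤ f x) ∧ f 0 = 1 ∧ ∀ x, δ ≤ |x| → f x = 0 := by
  let f : ContDiffBump (0 : ℝ) := ⟨δ / 2, δ, by positivity, by linarith⟩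
  exact ⟨f, f.contDiff, f.hasCompactSupport, fun x => f.nonneg,
    f.one_of_mem_closedBall (by simpa [f] using (half_pos hδ).le), fun x hx => f.zero_of_le_dist (by simpa [f])⟩

/-- A bump concentrated near 0 works: for |ξ| ≤ R the phase stays within π/4 on its support, so the
real part of the transform is positive. -/
theorem exists_testFunction_fourier_ne_zero (R : ℝ) : ∃ ψ : ℝ → ℝ, ContDiff ℝ ∞ ψ ∧
    HasCompactSupport ψ ∧ ∀ ξ, |ξ| ≤ R → 𝓕 (fun x => (ψ x : ℂ)) ξ ≠ 0 := by
  -- With this width |xξ| ≤ 1/8, hence |2πxξ| ≤ π/4.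
  set δ : ℝ := 1 / (8 * (|R| + 1)) with hδ
  have hδ0 : 0 < δ := by positivity
  obtain ⟨f, hfd, hfc, hf0, hf1, hfs⟩ := exists_testFunction_supported hδ0
  have hf : Continuous f := hfd.continuous
  refine ⟨f, hfd, hfc, fun ξ hξ h0 => ?_⟩
  have hre : (𝓕 (fun x => (f x : ℂ)) ξ).re = ∫ x, f x * Real.cos (2 * Real.pi * x * ξ) := by
    rw [Real.fourier_real_eq_integral_exp_smul, ← RCLike.re_eq_complex_re, ← integral_re]
    · congr 1
      ext x
      rw [smul_eq_mul, RCLike.re_eq_complex_re, Complex.re_mul_ofReal, Complex.exp_ofReal_mul_I_re,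
        mul_comm]
      congr 1
      rw [← Real.cos_neg]
      congr 1
      ring
    · refine Continuous.integrable_of_hasCompactSupport (by fun_prop) ?_
      exact HasCompactSupport.intro hfc
        fun x hx => by simp [image_eq_zero_of_notMem_tsupport hx]
  have hpos : 0 < ∫ x, f x * Real.cos (2 * Real.pi * x * ξ) := by
    refine Continuous.integral_pos_of_hasCompactSupport_nonneg_nonzero (x := 0) (by fun_prop)
      hfc.mul_right (fun x => ?_) ?_
    · by_cases hx : |x| < δ
      · refine mul_nonneg (hf0 x) (Real.cos_nonneg_of_mem_Icc ?_)
        rw [mem_Icc, ← abs_le, abs_mul, abs_mul, abs_of_pos (by positivity)]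
        have h1 : |x| * |ξ| ≤ δ * (|R| + 1) := by
          gcongr
          exact hξ.trans ((le_abs_self R).trans (by simp))
        have h2 : δ * (|R| + 1) = 1 / 8 := by
          rw [hδ]
          field_simp
        rw [mul_assoc]
        nlinarith [Real.pi_pos]
      · rw [hfs x (not_lt.1 hx)]
        simp
    · rw [hf1]
      simp
  rw [← hre, h0] at hpos
  simp at hpos

/-- Translating ψ by a multiplies its transform by a character. The hypothesis for all translates
says that g times conj ψ̂ has zero Fourier transform, so this product vanishes, and ψ̂ can be chosen
without zeros on any bounded interval. -/
theorem ae_eq_zero_of_integral_mul_conj_fourier {g : ℝ → ℂ}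
    (hg : ∀ ψ : ℝ → ℝ, ContDiff ℝ ∞ ψ → HasCompactSupport ψ →
      Integrable (fun ξ => g ξ * conj (𝓕 (fun x => (ψ x : ℂ)) ξ)) ∧
        ∫ ξ, g ξ * conj (𝓕 (fun x => (ψ x : ℂ)) ξ) = 0) :
    g =ᵐ[volume] 0 := by
  have key (ψ : ℝ → ℝ) (h : ContDiff ℝ ∞ ψ) (hc : HasCompactSupport ψ) :
      (fun ξ => g ξ * conj (𝓕 (fun x => (ψ x : ℂ)) ξ)) =ᵐ[volume] 0 := by
    refine ae_eq_zero_of_fourier_eq_zero (hg ψ h hc).1 fun a => ?_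
    have := (hg (fun x => ψ (x + a)) (h.comp (contDiff_id.add contDiff_const))
      (hc.comp_homeomorph (Homeomorph.addRight a))).2
    rw [← this, Real.fourier_real_eq_integral_exp_smul]
    congr 1
    ext ξ
    rw [fourier_comp_add_right (fun x => (ψ x : ℂ)), map_mul, ← Complex.exp_conj, smul_eq_mul,
      mul_left_comm]
    congr 3
    rw [map_mul, Complex.conj_ofReal, Complex.conj_I]
    push_cast
    ring
  have hn (n : ℕ) : ∀ᵐ ξ : ℝ, |ξ| ≤ n → g ξ = 0 := by
    obtain ⟨ψ, h, hc, hne⟩ := exists_testFunction_fourier_ne_zero n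
    filter_upwards [key ψ h hc] with ξ hξ hξn
    simpa [hne ξ hξn] using hξ
  filter_upwards [ae_all_iff.2 hn] with ξ hξ
  obtain ⟨n, hn⟩ := exists_nat_ge |ξ|
  exact hξ n hn

/-! ### The given operators as kernel convolutions -/

theorem rlKernel_one_sub_mul (σ : ℝ) (u : ℝ → ℝ) (x : ℝ) :
    (fun y => rlKernel 1 σ 0 (x - y) * u y) =
      fun y => (Real.Gamma σ)⁻¹ * (Iio x).indicator (fun y => (x - y) ^ (σ - 1) * u y) y := by
  ext y
  by_cases h : y < x
  · simp [rlKernel, h, mul_assoc]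
  · simp [rlKernel, h]

theorem rlKernel_neg_one_sub_mul (σ : ℝ) (u : ℝ → ℝ) (x : ℝ) :
    (fun y => rlKernel (-1) σ 0 (x - y) * u y) =
      fun y => (Real.Gamma σ)⁻¹ * (Ioi x).indicator (fun y => (y - x) ^ (σ - 1) * u y) y := by
  ext y
  by_cases h : x < y
  · simp [rlKernel, h, mul_assoc]
  · simp [rlKernel, h]

theorem leftRLIntegral_eq_convolution (σ : ℝ) (u : ℝ → ℝ) :
    leftRLIntegral σ u = rlKernel 1 σ 0 ⋆[ContinuousLinearMap.mul ℝ ℝ, volume] u := by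
  ext x
  rw [convolution_mul_swap, rlKernel_one_sub_mul, integral_const_mul,
    integral_indicator measurableSet_Iio, leftRLIntegral, one_div]

theorem rightRLIntegral_eq_convolution (σ : ℝ) (u : ℝ → ℝ) :
    rightRLIntegral σ u = rlKernel (-1) σ 0 ⋆[ContinuousLinearMap.mul ℝ ℝ, volume] u := by
  ext x
  rw [convolution_mul_swap, rlKernel_neg_one_sub_mul, integral_const_mul,
    integral_indicator measurableSet_Ioi, rightRLIntegral, one_div]

theorem deriv_convolution_rlKernel {e : ℝ} (he : e = 1 ∨ e = -1) {σ : ℝ} (hσ : 0 < σ)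
    {ψ : ℝ → ℝ} (h : ContDiff ℝ ∞ ψ) (hc : HasCompactSupport ψ) (x : ℝ) :
    deriv (rlKernel e σ 0 ⋆[ContinuousLinearMap.mul ℝ ℝ, volume] ψ) x =
      (rlKernel e σ 0 ⋆[ContinuousLinearMap.mul ℝ ℝ, volume] deriv ψ) x :=
  (hc.hasDerivAt_convolution_right _ (locallyIntegrable_rlKernel he hσ)
    (h.of_le (by simp)) x).deriv

/-- The Riemann–Liouville derivative of order `s ∈ (0, 1)` of a test function, left for `e = 1`
and right for `e = -1`. -/
noncomputable def rlDeriv (e s : ℝ) (ψ : ℝ → ℝ) (x : ℝ) : ℝ :=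
  e * (rlKernel e (1 - s) 0 ⋆[ContinuousLinearMap.mul ℝ ℝ, volume] deriv ψ) x

section

variable {s : ℝ} (hs' : s < 1) {ψ : ℝ → ℝ} (h : ContDiff ℝ ∞ ψ)
  (hc : HasCompactSupport ψ)

include hs' h hc

theorem leftRLDeriv_eq : leftRLDeriv s ψ = rlDeriv 1 s ψ := by
  ext x
  have hf : ⌊s⌋₊ = 0 := Nat.floor_eq_zero.2 hs'
  rw [leftRLDeriv, hf, zero_add, iteratedDeriv_one, leftRLIntegral_eq_convolution, Nat.cast_one,
    deriv_convolution_rlKernel (Or.inl rfl) (by linarith) h hc, rlDeriv, one_mul]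

theorem rightRLDeriv_eq : rightRLDeriv s ψ = rlDeriv (-1) s ψ := by
  ext x
  have hf : ⌊s⌋₊ = 0 := Nat.floor_eq_zero.2 hs'
  rw [rightRLDeriv, hf, zero_add, iteratedDeriv_one, rightRLIntegral_eq_convolution, Nat.cast_one,
    deriv_convolution_rlKernel (Or.inr rfl) (by linarith) h hc, rlDeriv, pow_one]

end

/-- `w` is the weak Riemann–Liouville derivative of order `s ∈ (0, 1)` of `u`, left for `e = 1` and
right for `e = -1`. -/
def IsWeakDeriv (e s : ℝ) (u w : ℝ → ℝ) : Prop :=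
  LocallyIntegrable u ∧ LocallyIntegrable w ∧
    ∀ ψ : ℝ → ℝ, ContDiff ℝ ∞ ψ → HasCompactSupport ψ →
      Integrable (fun x => u x * rlDeriv (-e) s ψ x) ∧
        ∫ x, u x * rlDeriv (-e) s ψ x = ∫ x, w x * ψ x

/-- `w` is the absolutely convergent Riemann–Liouville integral of order `s > 0` of `u`, left for
`e = 1` and right for `e = -1`. -/
def IsRLIntegral (e s : ℝ) (u w : ℝ → ℝ) : Prop :=
  (∀ᵐ x : ℝ, Integrable fun y => rlKernel e s 0 (x - y) * u y) ∧
    w =ᵐ[volume] (rlKernel e s 0 ⋆[ContinuousLinearMap.mul ℝ ℝ, volume] u)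

/-- `f` is the sum of a Riemann–Liouville integral and a weak derivative of `u` of order `s`. -/
def IsRLDecomp (e₁ e₂ s : ℝ) (f u : ℝ → ℝ) : Prop :=
  ∃ a b : ℝ → ℝ, IsRLIntegral e₁ s u a ∧ IsWeakDeriv e₂ s u b ∧ f =ᵐ[volume] fun x => a x + b x

section

variable {s : ℝ} (hs : 0 < s) (u w : ℝ → ℝ)

include hs

theorem isLeftRL_neg_iff : IsLeftRL (-s) u w ↔ IsRLIntegral 1 s u w := by
  have h1 : ¬ 0 < -s := by linarith
  have h2 : ¬ -s = 0 := by linarith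
  have h3 : -s < 0 := by linarith
  have hΓ : IsUnit (Real.Gamma s)⁻¹ := by
    simp [(Real.Gamma_pos_of_pos hs).ne']
  simp only [IsLeftRL, h1, h2, h3, false_imp_iff, true_imp_iff, true_and, neg_neg, IsRLIntegral,
    leftRLIntegral_eq_convolution, rlKernel_one_sub_mul, integrable_const_mul_iff hΓ,
    integrable_indicator_iff measurableSet_Iio]

theorem isRightRL_neg_iff : IsRightRL (-s) u w ↔ IsRLIntegral (-1) s u w := by
  have h1 : ¬ 0 < -s := by linarith
  have h2 : ¬ -s = 0 := by linarith
  have h3 : -s < 0 := by linarith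
  have hΓ : IsUnit (Real.Gamma s)⁻¹ := by
    simp [(Real.Gamma_pos_of_pos hs).ne']
  simp only [IsRightRL, h1, h2, h3, false_imp_iff, true_imp_iff, true_and, neg_neg, IsRLIntegral,
    rightRLIntegral_eq_convolution, rlKernel_neg_one_sub_mul, integrable_const_mul_iff hΓ,
    integrable_indicator_iff measurableSet_Ioi]

variable (hs' : s < 1)

include hs'

theorem isLeftRL_iff : IsLeftRL s u w ↔ IsWeakDeriv 1 s u w := by
  have h2 : ¬ s = 0 := hs.ne'
  have h3 : ¬ s < 0 := hs.not_gt
  simp only [IsLeftRL, hs, h2, h3, false_imp_iff, true_imp_iff, and_true, IsWeakLeftDeriv,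
    IsWeakDeriv]
  refine and_congr_right fun _ => and_congr_right fun _ => forall_congr' fun ψ =>
    forall_congr' fun h => forall_congr' fun hc => ?_
  rw [rightRLDeriv_eq hs' h hc]

theorem isRightRL_iff : IsRightRL s u w ↔ IsWeakDeriv (-1) s u w := by
  have h2 : ¬ s = 0 := hs.ne'
  have h3 : ¬ s < 0 := hs.not_gt
  simp only [IsRightRL, hs, h2, h3, false_imp_iff, true_imp_iff, and_true, IsWeakRightDeriv,
    IsWeakDeriv, neg_neg]
  refine and_congr_right fun _ => and_congr_right fun _ => forall_congr' fun ψ =>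
    forall_congr' fun h => forall_congr' fun hc => ?_
  rw [leftRLDeriv_eq hs' h hc]

end

section

variable {s : ℝ} (hs : 0 < s) (hs' : s < 1) (f u : ℝ → ℝ)

include hs hs'

theorem isLeftRightDecomp_iff : IsLeftRightDecomp s f u ↔ IsRLDecomp 1 (-1) s f u := by
  simp only [IsLeftRightDecomp, IsRLDecomp, isLeftRL_neg_iff hs, isRightRL_iff hs _ _ hs']

theorem isLeftLeftDecomp_iff : IsLeftLeftDecomp s f u ↔ IsRLDecomp 1 1 s f u := by
  simp only [IsLeftLeftDecomp, IsRLDecomp, isLeftRL_neg_iff hs, isLeftRL_iff hs _ _ hs']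

/-- For negative order the right operator is the integral and the left one the derivative, so the
two summands are swapped. -/
theorem isLeftRightDecomp_neg_iff : IsLeftRightDecomp (-s) f u ↔ IsRLDecomp (-1) 1 s f u := by
  simp only [IsLeftRightDecomp, IsRLDecomp, isRightRL_neg_iff hs, neg_neg,
    isLeftRL_iff hs _ _ hs']
  rw [exists_comm]
  simp only [add_comm, and_left_comm]

theorem isLeftLeftDecomp_neg_iff : IsLeftLeftDecomp (-s) f u ↔ IsRLDecomp 1 1 s f u := by
  simp only [IsLeftLeftDecomp, IsRLDecomp, isLeftRL_neg_iff hs, neg_neg,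
    isLeftRL_iff hs _ _ hs']
  rw [exists_comm]
  simp only [add_comm, and_left_comm]

end

/-! ### The combined symbol and the equation on the Fourier side -/

/-- The Fourier multiplier `(2 π i e₁ ξ) ^ (-s) + (2 π i e₂ ξ) ^ s`. -/
noncomputable def sumSymbol (e₁ e₂ s ξ : ℝ) : ℂ := fracSymbol e₁ (-s) ξ + fracSymbol e₂ s ξ

@[fun_prop]
theorem measurable_sumSymbol (e₁ e₂ s : ℝ) : Measurable (sumSymbol e₁ e₂ s) := by
  unfold sumSymbol
  fun_prop

theorem sumSymbol_neg (e₁ e₂ s ξ : ℝ) : sumSymbol e₁ e₂ s (-ξ) = conj (sumSymbol e₁ e₂ s ξ) := by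
  simp [sumSymbol, fracSymbol_neg_right]

theorem ae_ne_zero : ∀ᵐ ξ : ℝ, ξ ≠ 0 :=
  compl_mem_ae_iff.2 (measure_singleton (μ := volume) (0 : ℝ))

theorem one_le_rpow_add_rpow_neg {ρ s : ℝ} (hρ : 0 < ρ) (hs : 0 ≤ s) : 1 ≤ ρ ^ s + ρ ^ (-s) := by
  rcases le_total 1 ρ with h | h
  · have := Real.one_le_rpow h hs
    have := Real.rpow_nonneg hρ.le (-s)
    linarith
  · have := Real.one_le_rpow_of_pos_of_le_one_of_nonpos hρ h (neg_nonpos.2 hs)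
    have := Real.rpow_nonneg hρ.le s
    linarith

section

variable {e₁ e₂ : ℝ} (he₁ : e₁ = 1 ∨ e₁ = -1) (he₂ : e₂ = 1 ∨ e₂ = -1) {s : ℝ}

include he₁ he₂

theorem norm_sumSymbol_le (ξ : ℝ) :
    ‖sumSymbol e₁ e₂ s ξ‖ ≤ |2 * Real.pi * ξ| ^ s + |2 * Real.pi * ξ| ^ (-s) := by
  refine (norm_add_le _ _).trans_eq ?_
  rw [norm_fracSymbol he₁, norm_fracSymbol he₂, add_comm]

/-- The modulus is at least the real part, and both terms carry the same cosine. -/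
theorem le_norm_sumSymbol {ξ : ℝ} (hξ : ξ ≠ 0) :
    Real.cos (Real.pi / 2 * s) * (|2 * Real.pi * ξ| ^ s + |2 * Real.pi * ξ| ^ (-s)) ≤
      ‖sumSymbol e₁ e₂ s ξ‖ := by
  refine le_trans (le_of_eq ?_) (Complex.re_le_norm _)
  rw [sumSymbol, Complex.add_re, re_fracSymbol he₁ _ hξ, re_fracSymbol he₂ _ hξ, mul_neg,
    Real.cos_neg]
  ring

variable (hs : 0 < s) (hs' : s < 1 / 2)

omit he₁ he₂ in
include hs hs' in
theorem cos_pi_div_two_mul_pos : 0 < Real.cos (Real.pi / 2 * s) := by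
  refine Real.cos_pos_of_mem_Ioo ⟨?_, ?_⟩ <;> nlinarith [Real.pi_pos]

include hs hs'

theorem cos_le_norm_sumSymbol {ξ : ℝ} (hξ : ξ ≠ 0) :
    Real.cos (Real.pi / 2 * s) ≤ ‖sumSymbol e₁ e₂ s ξ‖ := by
  refine le_trans ?_ (le_norm_sumSymbol he₁ he₂ hξ)
  refine le_mul_of_one_le_right (cos_pi_div_two_mul_pos hs hs').le ?_
  exact one_le_rpow_add_rpow_neg (abs_pos.2 (by positivity)) hs.le

omit he₂ in
-- Fubini moves the kernel to ψ and reverses its direction. Conjugating the reversed symbol restores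
-- the original multiplier on û.
theorem IsRLIntegral.integral_mul_eq_plancherel {u : Lp ℝ 2 (volume : Measure ℝ)} {a : ℝ → ℝ}
    (ha : IsRLIntegral e₁ s u a) {ψ : ℝ → ℝ} (h : ContDiff ℝ ∞ ψ) (hc : HasCompactSupport ψ) :
    Integrable (fun x => a x * ψ x) ∧
    ((∫ x, a x * ψ x : ℝ) : ℂ) = ∫ ξ, plancherel u ξ * conj (fracSymbol (-e₁) (-s) ξ *
      𝓕 (fun x => (ψ x : ℂ)) ξ) := by
  have he' : -e₁ = 1 ∨ -e₁ = -1 := by rcases he₁ with rfl | rfl <;> simp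
  have h1 : (fun x => (rlKernel e₁ s 0 ⋆[ContinuousLinearMap.mul ℝ ℝ, volume] u) x * ψ x)
      =ᵐ[volume] fun x => a x * ψ x := by
    filter_upwards [ha.2] with x hx
    rw [hx]
  constructor
  · refine Integrable.congr ?_ h1
    simpa [mul_comm] using (locallyIntegrable_rlKernel_convolution he₁ hs hs'
      (Lp.memLp u)).integrable_smul_left_of_hasCompactSupport h.continuous hc
  · rw [← integral_congr_ae h1,
      integral_rlKernel_convolution_mul he₁ hs hs' (Lp.memLp u) h.continuous hc]
    obtain ⟨hm, hp⟩ := plancherel_convolution_rlKernel h hc he' hs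
      (memLp_fracSymbol_neg_mul_fourier h hc he' hs hs')
    exact (integral_mul_eq_of_plancherel hm hp u).2

omit he₁ in
theorem integral_mul_rlDeriv (u : Lp ℝ 2 (volume : Measure ℝ))
    {ψ : ℝ → ℝ} (h : ContDiff ℝ ∞ ψ) (hc : HasCompactSupport ψ) :
    Integrable (fun x => u x * rlDeriv (-e₂) s ψ x) ∧
    ((∫ x, u x * rlDeriv (-e₂) s ψ x : ℝ) : ℂ) =
      ∫ ξ, plancherel u ξ * conj (fracSymbol (-e₂) s ξ * 𝓕 (fun x => (ψ x : ℂ)) ξ) := by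
  have he' : -e₂ = 1 ∨ -e₂ = -1 := by rcases he₂ with rfl | rfl <;> simp
  obtain ⟨hm, hp⟩ := plancherel_rlDeriv h hc he' hs (by linarith)
  exact integral_mul_eq_of_plancherel hm hp u

/-- The source of uniqueness: the decomposition tested against ψ becomes the multiplier equation
tested against ψ̂. -/
theorem IsRLDecomp.plancherel_eq {f u : Lp ℝ 2 (volume : Measure ℝ)}
    (hd : IsRLDecomp e₁ e₂ s f u) :
    ∀ᵐ ξ, plancherel f ξ = sumSymbol e₁ e₂ s ξ * plancherel u ξ := by
  have he₁' : -e₁ = 1 ∨ -e₁ = -1 := by rcases he₁ with rfl | rfl <;> simp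
  have he₂' : -e₂ = 1 ∨ -e₂ = -1 := by rcases he₂ with rfl | rfl <;> simp
  obtain ⟨a, b, ha, ⟨-, hb, hb'⟩, hf⟩ := hd
  suffices (fun ξ => plancherel f ξ - sumSymbol e₁ e₂ s ξ * plancherel u ξ) =ᵐ[volume] 0 by
    filter_upwards [this] with ξ hξ
    exact sub_eq_zero.1 hξ
  refine ae_eq_zero_of_integral_mul_conj_fourier fun ψ h hc => ?_
  have hm := memLp_testFunction h hc
  obtain ⟨hf1, hf2⟩ := integral_mul_eq_of_plancherel hm (plancherel_toLp_testSchwartz h hc hm) f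
  obtain ⟨ha1, ha2⟩ := ha.integral_mul_eq_plancherel he₁ hs hs' h hc
  obtain ⟨hu1, hu2⟩ := integral_mul_rlDeriv he₂ hs hs' u h hc
  have hb1 : Integrable fun x => b x * ψ x := by
    simpa [mul_comm] using hb.integrable_smul_left_of_hasCompactSupport h.continuous hc
  have hI0 := integrable_plancherel_mul_conj (Lp.memLp (plancherel f))
    (memLp_fourier_testFunction h hc)
  have hI1 := integrable_plancherel_mul_conj (Lp.memLp (plancherel u))
    (memLp_fracSymbol_neg_mul_fourier h hc he₁' hs hs')
  have hI2 := integrable_plancherel_mul_conj (Lp.memLp (plancherel u))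
    (memLp_fracSymbol_mul_fourier h hc he₂' hs (by linarith))
  have heq : (fun ξ => (plancherel f ξ - sumSymbol e₁ e₂ s ξ * plancherel u ξ) *
      conj (𝓕 (fun x => (ψ x : ℂ)) ξ)) = fun ξ =>
      plancherel f ξ * conj (𝓕 (fun x => (ψ x : ℂ)) ξ) -
      (plancherel u ξ * conj (fracSymbol (-e₁) (-s) ξ * 𝓕 (fun x => (ψ x : ℂ)) ξ) +
      plancherel u ξ * conj (fracSymbol (-e₂) s ξ * 𝓕 (fun x => (ψ x : ℂ)) ξ)) := by
    ext ξ
    simp only [sumSymbol, map_mul, fracSymbol_neg_left, Complex.conj_conj]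
    ring
  rw [heq]
  refine ⟨hI0.sub (hI1.add hI2), ?_⟩
  have hsum : ∫ x, f x * ψ x = (∫ x, a x * ψ x) + ∫ x, b x * ψ x := by
    rw [← integral_add ha1 hb1]
    refine integral_congr_ae ?_
    filter_upwards [hf] with x hx
    rw [hx, add_mul]
  refine (integral_sub hI0 (hI1.add hI2)).trans ?_
  rw [integral_add' hI1 hI2, ← hf2, ← ha2, ← hu2, hsum, (hb' ψ h hc).2]
  push_cast
  ring

/-- The weak derivative is built from its transform (2πie₂ξ)^s û, which lies in L² because its
modulus is at most |f̂|/cos(πs/2). The fractional integral is then identified with the rest of f by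
testing. -/
theorem isRLDecomp_of_plancherel_eq {f u : Lp ℝ 2 (volume : Measure ℝ)}
    (hfu : ∀ᵐ ξ, plancherel f ξ = sumSymbol e₁ e₂ s ξ * plancherel u ξ) :
    IsRLDecomp e₁ e₂ s f u := by
  have he₁' : -e₁ = 1 ∨ -e₁ = -1 := by rcases he₁ with rfl | rfl <;> simp
  have hF : MemLp (fun ξ => fracSymbol e₂ s ξ * plancherel u ξ) 2 := by
    refine MemLp.of_le_mul (c := (Real.cos (Real.pi / 2 * s))⁻¹) (Lp.memLp (plancherel f))
      ((measurable_fracSymbol e₂ s).aestronglyMeasurable.mul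
        (Lp.memLp (plancherel u)).aestronglyMeasurable) ?_
    filter_upwards [hfu, ae_ne_zero] with ξ hξ h0
    have hcos := cos_pi_div_two_mul_pos hs hs'
    rw [hξ, norm_mul, norm_mul, ← mul_assoc, norm_fracSymbol he₂]
    gcongr
    rw [inv_mul_eq_div, le_div_iff₀' hcos]
    refine le_trans ?_ (le_norm_sumSymbol he₁ he₂ h0)
    gcongr
    have := Real.rpow_nonneg (abs_nonneg (2 * Real.pi * ξ)) (-s)
    linarith
  obtain ⟨b, hb⟩ := exists_plancherel_eq (F := hF.toLp) <| by
    filter_upwards [hF.coeFn_toLp, (Measure.measurePreserving_neg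
      (volume : Measure ℝ)).quasiMeasurePreserving.ae hF.coeFn_toLp, plancherel_neg u]
      with ξ h1 h2 h3
    rw [h1, h2, h3, fracSymbol_neg_right]
    simp
  have hbF : ∀ᵐ ξ, plancherel b ξ = fracSymbol e₂ s ξ * plancherel u ξ := by
    rw [hb]
    exact hF.coeFn_toLp
  have hloc (v : Lp ℝ 2 (volume : Measure ℝ)) : LocallyIntegrable v :=
    (Lp.memLp v).locallyIntegrable (by norm_num)
  have hint (v : Lp ℝ 2 (volume : Measure ℝ)) {ψ : ℝ → ℝ} (h : ContDiff ℝ ∞ ψ)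
      (hc : HasCompactSupport ψ) :=
    integral_mul_eq_of_plancherel (memLp_testFunction h hc)
      (plancherel_toLp_testSchwartz h hc (memLp_testFunction h hc)) v
  have hbψ {ψ : ℝ → ℝ} (h : ContDiff ℝ ∞ ψ) (hc : HasCompactSupport ψ) :
      ((∫ x, b x * ψ x : ℝ) : ℂ) =
        ∫ ξ, plancherel u ξ * conj (fracSymbol (-e₂) s ξ * 𝓕 (fun x => (ψ x : ℂ)) ξ) := by
    rw [(hint b h hc).2]
    refine integral_congr_ae ?_
    filter_upwards [hbF] with ξ hξ
    rw [hξ, fracSymbol_neg_left, map_mul, Complex.conj_conj]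
    ring
  set a := rlKernel e₁ s 0 ⋆[ContinuousLinearMap.mul ℝ ℝ, volume] u
  have ha : IsRLIntegral e₁ s u a :=
    ⟨ae_integrable_rlKernel_mul he₁ hs hs' (Lp.memLp u), .rfl⟩
  refine ⟨a, b, ha, ⟨hloc u, hloc b, fun ψ h hc => ?_⟩, ?_⟩
  · obtain ⟨hu1, hu2⟩ := integral_mul_rlDeriv he₂ hs hs' u h hc
    refine ⟨hu1, ?_⟩
    rw [← Complex.ofReal_inj, hu2, hbψ h hc]
  · have haloc : LocallyIntegrable a :=
      locallyIntegrable_rlKernel_convolution he₁ hs hs' (Lp.memLp u)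
    refine ae_eq_of_integral_contDiff_smul_eq (hloc f) (haloc.add (hloc b)) fun ψ h hc => ?_
    obtain ⟨ha1, ha2⟩ := ha.integral_mul_eq_plancherel he₁ hs hs' h hc
    obtain ⟨hu1, hu2⟩ := integral_mul_rlDeriv he₂ hs hs' u h hc
    have h1 : ∫ x, ψ x • (a x + b x) = (∫ x, a x * ψ x) + ∫ x, b x * ψ x := by
      rw [← integral_add ha1 (hint b h hc).1]
      congr 1
      ext x
      rw [smul_eq_mul]
      ring
    have h2 : ∫ x, ψ x • f x = ∫ x, f x * ψ x := by simp [mul_comm]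
    have hI1 := integrable_plancherel_mul_conj (Lp.memLp (plancherel u))
      (memLp_fracSymbol_neg_mul_fourier h hc he₁' hs hs')
    have hI2 := integrable_plancherel_mul_conj (Lp.memLp (plancherel u))
      (memLp_fracSymbol_mul_fourier h hc
        (show -e₂ = 1 ∨ -e₂ = -1 by rcases he₂ with rfl | rfl <;> simp) hs (by linarith))
    refine Eq.trans ?_ h1.symm
    rw [h2, ← Complex.ofReal_inj, Complex.ofReal_add, ha2, hbψ h hc, (hint f h hc).2,
      ← integral_add hI1 hI2]
    refine integral_congr_ae ?_
    filter_upwards [hfu] with ξ hξ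
    rw [hξ, sumSymbol, fracSymbol_neg_left, fracSymbol_neg_left, map_mul, map_mul,
      Complex.conj_conj, Complex.conj_conj]
    ring

/-- Divide by the symbol: its inverse is bounded by 1/cos(πs/2), and its Hermitian symmetry makes
the quotient the transform of a real function. -/
theorem exists_plancherel_eq_sumSymbol_mul (f : Lp ℝ 2 (volume : Measure ℝ)) :
    ∃ u : Lp ℝ 2 (volume : Measure ℝ),
      ∀ᵐ ξ, plancherel f ξ = sumSymbol e₁ e₂ s ξ * plancherel u ξ := by
  have hcos := cos_pi_div_two_mul_pos hs hs'
  have hF : MemLp (fun ξ => (sumSymbol e₁ e₂ s ξ)⁻¹ * plancherel f ξ) 2 := by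
    refine MemLp.of_le_mul (c := (Real.cos (Real.pi / 2 * s))⁻¹) (Lp.memLp (plancherel f))
      ((measurable_sumSymbol e₁ e₂ s).inv.aestronglyMeasurable.mul
        (Lp.memLp (plancherel f)).aestronglyMeasurable) ?_
    filter_upwards [ae_ne_zero] with ξ h0
    rw [norm_mul, norm_inv]
    gcongr
    exact cos_le_norm_sumSymbol he₁ he₂ hs hs' h0
  obtain ⟨u, hu⟩ := exists_plancherel_eq (F := hF.toLp) <| by
    filter_upwards [hF.coeFn_toLp, (Measure.measurePreserving_neg
      (volume : Measure ℝ)).quasiMeasurePreserving.ae hF.coeFn_toLp, plancherel_neg f]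
      with ξ h1 h2 h3
    rw [h1, h2, h3, sumSymbol_neg]
    simp
  refine ⟨u, ?_⟩
  rw [hu]
  filter_upwards [hF.coeFn_toLp, ae_ne_zero] with ξ h1 h0
  have : sumSymbol e₁ e₂ s ξ ≠ 0 :=
    norm_pos_iff.1 (hcos.trans_le (cos_le_norm_sumSymbol he₁ he₂ hs hs' h0))
  rw [h1, mul_inv_cancel_left₀ this]

end

/-! ### Transfer of Sobolev regularity -/

theorem aestronglyMeasurable_sobolev (μ : ℝ) (u : Lp ℝ 2 (volume : Measure ℝ)) :
    AEStronglyMeasurable fun ξ : ℝ =>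
      (1 + |2 * Real.pi * ξ| ^ (2 * μ)) * ‖plancherel u ξ‖ ^ 2 := by
  refine AEStronglyMeasurable.mul (Measurable.aestronglyMeasurable (by fun_prop)) ?_
  exact (Lp.aestronglyMeasurable _).norm.pow 2

theorem integrable_plancherel_sq (u : Lp ℝ 2 (volume : Measure ℝ)) :
    Integrable fun ξ : ℝ => ‖plancherel u ξ‖ ^ 2 :=
  (Lp.memLp (plancherel u)).integrable_norm_pow (by norm_num)

theorem mem_sobolevHat_iff {μ : ℝ} {u : Lp ℝ 2 (volume : Measure ℝ)} : u ∈ sobolevHat μ ↔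
    Integrable fun ξ : ℝ => (1 + |2 * Real.pi * ξ| ^ (2 * μ)) * ‖plancherel u ξ‖ ^ 2 :=
  Iff.rfl

theorem mem_sobolevHat_zero (u : Lp ℝ 2 (volume : Measure ℝ)) : u ∈ sobolevHat 0 := by
  rw [mem_sobolevHat_iff]
  simpa using (integrable_plancherel_sq u).const_mul (1 + 1)

section

variable {e₁ e₂ : ℝ} (he₁ : e₁ = 1 ∨ e₁ = -1) (he₂ : e₂ = 1 ∨ e₂ = -1) {s : ℝ}
  (hs : 0 < s) (hs' : s < 1 / 2) {f u : Lp ℝ 2 (volume : Measure ℝ)}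
  (hfu : ∀ᵐ ξ, plancherel f ξ = sumSymbol e₁ e₂ s ξ * plancherel u ξ)

include he₁ he₂ hs hs' hfu

/-- |m| ≥ cA, where A = ρ^s + ρ^(-s) is at least 1 and at least ρ^s, so A² absorbs the extra weight.
-/
theorem mem_sobolevHat_add {t : ℝ} (hf : f ∈ sobolevHat t) : u ∈ sobolevHat (s + t) := by
  have hcos := cos_pi_div_two_mul_pos hs hs'
  set c := Real.cos (Real.pi / 2 * s)
  rw [mem_sobolevHat_iff] at hf ⊢
  refine (hf.const_mul (c ^ 2)⁻¹).mono' (aestronglyMeasurable_sobolev _ _) ?_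
  filter_upwards [hfu, ae_ne_zero] with ξ hξ h0
  rw [Real.norm_of_nonneg (by positivity), inv_mul_eq_div, le_div_iff₀ (by positivity), hξ,
    norm_mul]
  have hlow := le_norm_sumSymbol he₁ he₂ h0 (s := s)
  have hρ : 0 < |2 * Real.pi * ξ| := by positivity
  set ρ := |2 * Real.pi * ξ|
  have h1 := one_le_rpow_add_rpow_neg hρ hs.le
  have h2 : ρ ^ (2 * (s + t)) = (ρ ^ s) ^ 2 * ρ ^ (2 * t) := by
    rw [mul_add, Real.rpow_add hρ, mul_comm 2 s, Real.rpow_mul hρ.le, Real.rpow_two]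
  have h3 : 0 < ρ ^ s := Real.rpow_pos_of_pos hρ s
  have h4 : 0 < ρ ^ (-s) := Real.rpow_pos_of_pos hρ (-s)
  have h5 : 0 < ρ ^ (2 * t) := Real.rpow_pos_of_pos hρ _
  set A := ρ ^ s + ρ ^ (-s)
  have h6 : (ρ ^ s) ^ 2 ≤ A ^ 2 := by
    gcongr
    linarith
  have h7 : 1 + ρ ^ (2 * (s + t)) ≤ (1 + ρ ^ (2 * t)) * A ^ 2 := by
    rw [h2]
    nlinarith
  calc (1 + ρ ^ (2 * (s + t))) * ‖plancherel u ξ‖ ^ 2 * c ^ 2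
      ≤ (1 + ρ ^ (2 * t)) * A ^ 2 * ‖plancherel u ξ‖ ^ 2 * c ^ 2 := by gcongr
    _ = (1 + ρ ^ (2 * t)) * ((c * A) * ‖plancherel u ξ‖) ^ 2 := by ring
    _ ≤ _ := by gcongr

omit hs' in
-- The symbol is unbounded at the origin, so û cannot control f̂ there; but for ρ ≤ 1 the weight is
-- at most 2 and f ∈ L² suffices. For ρ ≥ 1, |m| ≤ 2ρ^s, whence the factor 4.
theorem mem_sobolevHat_of_add {t : ℝ} (ht : 0 ≤ t) (hu : u ∈ sobolevHat (s + t)) :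
    f ∈ sobolevHat t := by
  rw [mem_sobolevHat_iff] at hu ⊢
  refine (((integrable_plancherel_sq f).const_mul 2).add (hu.const_mul 4)).mono'
    (aestronglyMeasurable_sobolev _ _) ?_
  filter_upwards [hfu, ae_ne_zero] with ξ hξ h0
  rw [Real.norm_of_nonneg (by positivity), Pi.add_apply]
  have hup := norm_sumSymbol_le he₁ he₂ ξ (s := s)
  have hρ : 0 < |2 * Real.pi * ξ| := by positivity
  set ρ := |2 * Real.pi * ξ|
  have h2 : ρ ^ (2 * (s + t)) = (ρ ^ s) ^ 2 * ρ ^ (2 * t) := by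
    rw [mul_add, Real.rpow_add hρ, mul_comm 2 s, Real.rpow_mul hρ.le, Real.rpow_two]
  have h5 : 0 < ρ ^ (2 * t) := Real.rpow_pos_of_pos hρ _
  rcases le_total ρ 1 with h | h
  · have h6 : ρ ^ (2 * t) ≤ 1 := Real.rpow_le_one hρ.le h (by linarith)
    have h7 : 0 ≤ 4 * ((1 + ρ ^ (2 * (s + t))) * ‖plancherel u ξ‖ ^ 2) := by positivity
    nlinarith [sq_nonneg ‖plancherel f ξ‖]
  · have h6 : ρ ^ (-s) ≤ ρ ^ s := Real.rpow_le_rpow_of_exponent_le h (by linarith)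
    have h7 : ‖plancherel f ξ‖ ≤ 2 * ρ ^ s * ‖plancherel u ξ‖ := by
      rw [hξ, norm_mul]
      gcongr
      linarith
    have h8 : ‖plancherel f ξ‖ ^ 2 ≤ 4 * ((ρ ^ s) ^ 2 * ‖plancherel u ξ‖ ^ 2) :=
      (pow_le_pow_left₀ (norm_nonneg _) h7 2).trans_eq (by ring)
    have h9 := mul_le_mul_of_nonneg_left h8 h5.le
    rw [h2]
    nlinarith [sq_nonneg ‖plancherel f ξ‖, sq_nonneg ‖plancherel u ξ‖]

end

/-! ### Assembly, with order zero treated apart -/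

theorem exists_unique_isRLDecomp {e₁ e₂ : ℝ} (he₁ : e₁ = 1 ∨ e₁ = -1) (he₂ : e₂ = 1 ∨ e₂ = -1)
    {s : ℝ} (hs : 0 < s) (hs' : s < 1 / 2) (f : Lp ℝ 2 (volume : Measure ℝ)) :
    ∃ u : Lp ℝ 2 (volume : Measure ℝ), (u ∈ sobolevHat s ∧ IsRLDecomp e₁ e₂ s f u) ∧
      (∀ v : Lp ℝ 2 (volume : Measure ℝ), v ∈ sobolevHat s → IsRLDecomp e₁ e₂ s f v → v = u) ∧
      ∀ t : ℝ, 0 < t → (f ∈ sobolevHat t ↔ u ∈ sobolevHat (s + t)) := by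
  obtain ⟨u, hu⟩ := exists_plancherel_eq_sumSymbol_mul he₁ he₂ hs hs' f
  refine ⟨u, ⟨?_, isRLDecomp_of_plancherel_eq he₁ he₂ hs hs' hu⟩, fun v _ hv => ?_, fun t ht =>
    ⟨mem_sobolevHat_add he₁ he₂ hs hs' hu, mem_sobolevHat_of_add he₁ he₂ hs hu ht.le⟩⟩
  -- Membership in the space of order s is the regularity transfer at t = 0.
  · simpa using mem_sobolevHat_add he₁ he₂ hs hs' hu (mem_sobolevHat_zero f)
  · refine plancherel_injective (Lp.ext ?_)
    filter_upwards [hu, hv.plancherel_eq he₁ he₂ hs hs', ae_ne_zero] with ξ h1 h2 h0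
    have : sumSymbol e₁ e₂ s ξ ≠ 0 := norm_pos_iff.1 <|
      (cos_pi_div_two_mul_pos hs hs').trans_le (cos_le_norm_sumSymbol he₁ he₂ hs hs' h0)
    rw [h1] at h2
    exact (mul_left_cancel₀ this h2).symm

theorem isLeftLeftDecomp_zero_iff (f u : ℝ → ℝ) :
    IsLeftLeftDecomp 0 f u ↔ f =ᵐ[volume] fun x => 2 * u x := by
  simp only [IsLeftLeftDecomp, IsLeftRL, neg_zero, lt_irrefl, false_imp_iff, true_imp_iff,
    true_and, and_true]
  constructor
  · rintro ⟨a, b, ha, hb, hf⟩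
    filter_upwards [ha, hb, hf] with x h1 h2 h3
    rw [h3, h1, h2, two_mul]
  · exact fun hf => ⟨u, u, .rfl, .rfl, by simpa only [two_mul] using hf⟩

theorem isLeftRightDecomp_zero_iff (f u : ℝ → ℝ) :
    IsLeftRightDecomp 0 f u ↔ f =ᵐ[volume] fun x => 2 * u x := by
  rw [← isLeftLeftDecomp_zero_iff]
  simp only [IsLeftLeftDecomp, IsLeftRightDecomp, IsLeftRL, IsRightRL, neg_zero, lt_irrefl,
    false_imp_iff, true_imp_iff, true_and, and_true]

theorem smul_mem_sobolevHat {μ : ℝ} {u : Lp ℝ 2 (volume : Measure ℝ)} (c : ℝ)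
    (hu : u ∈ sobolevHat μ) : c • u ∈ sobolevHat μ := by
  have hp : plancherel (c • u) = (c : ℂ) • plancherel u := by
    have : (Complex.ofRealCLM.compLp (c • u) : Lp ℂ 2 (volume : Measure ℝ)) =
        (c : ℂ) • Complex.ofRealCLM.compLp u := by
      refine Lp.ext ?_
      filter_upwards [ofReal_compLp_ae (c • u), ofReal_compLp_ae u, Lp.coeFn_smul c u,
        Lp.coeFn_smul (c : ℂ) (Complex.ofRealCLM.compLp u : Lp ℂ 2 (volume : Measure ℝ))]
        with x h1 h2 h3 h4
      rw [h1, h4, h3, Pi.smul_apply, Pi.smul_apply, h2]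
      simp
    rw [plancherel, this, FourierTransform.fourier_smul, plancherel]
  rw [mem_sobolevHat_iff] at hu ⊢
  refine (hu.const_mul (c ^ 2)).congr ?_
  filter_upwards [Lp.coeFn_smul (c : ℂ) (plancherel u)] with ξ hξ
  rw [hp, hξ, Pi.smul_apply, norm_smul, Complex.norm_real, mul_pow, Real.norm_eq_abs, sq_abs]
  ring

/-- At order zero both operators are the identity, so u = f/2. -/
theorem exists_unique_two_mul (f : Lp ℝ 2 (volume : Measure ℝ)) :
    ∃ u : Lp ℝ 2 (volume : Measure ℝ), (u ∈ sobolevHat 0 ∧ f =ᵐ[volume] fun x => 2 * u x) ∧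
      (∀ v : Lp ℝ 2 (volume : Measure ℝ),
        v ∈ sobolevHat 0 → (f =ᵐ[volume] fun x => 2 * v x) → v = u) ∧
      ∀ t : ℝ, 0 < t → (f ∈ sobolevHat t ↔ u ∈ sobolevHat (0 + t)) := by
  refine ⟨(2⁻¹ : ℝ) • f, ⟨mem_sobolevHat_zero _, ?_⟩, fun v _ hv => Lp.ext ?_, fun t _ => ?_⟩
  · filter_upwards [Lp.coeFn_smul (2⁻¹ : ℝ) f] with x hx
    simp [hx]
  · filter_upwards [Lp.coeFn_smul (2⁻¹ : ℝ) f, hv] with x hx hv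
    simp [hx, hv]
  · rw [zero_add]
    refine ⟨smul_mem_sobolevHat _, fun h => ?_⟩
    simpa using smul_mem_sobolevHat 2 h

theorem mainTheorem1 (s : ℝ) (hs : -1 / 2 < s) (hs' : s < 1 / 2)
    (f : Lp ℝ 2 (volume : Measure ℝ)) :
    (∃ u : Lp ℝ 2 (volume : Measure ℝ),
      (u ∈ sobolevHat |s| ∧ IsLeftRightDecomp s f u) ∧
      (∀ v : Lp ℝ 2 (volume : Measure ℝ),
        v ∈ sobolevHat |s| → IsLeftRightDecomp s f v → v = u) ∧
      ∀ t : ℝ, 0 < t → (f ∈ sobolevHat t ↔ u ∈ sobolevHat (|s| + t))) ∧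
    (∃ u : Lp ℝ 2 (volume : Measure ℝ),
      (u ∈ sobolevHat |s| ∧ IsLeftLeftDecomp s f u) ∧
      (∀ v : Lp ℝ 2 (volume : Measure ℝ),
        v ∈ sobolevHat |s| → IsLeftLeftDecomp s f v → v = u) ∧
      ∀ t : ℝ, 0 < t → (f ∈ sobolevHat t ↔ u ∈ sobolevHat (|s| + t))) := by
  rcases lt_trichotomy s 0 with h | rfl | h
  · obtain ⟨r, rfl⟩ : ∃ r, s = -r := ⟨-s, (neg_neg s).symm⟩
    have h0 : 0 < r := by linarith
    have h1 : r < 1 / 2 := by linarith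
    have h2 : r < 1 := by linarith
    simp only [abs_neg, abs_of_pos h0, isLeftRightDecomp_neg_iff h0 h2,
      isLeftLeftDecomp_neg_iff h0 h2]
    exact ⟨exists_unique_isRLDecomp (.inr rfl) (.inl rfl) h0 h1 f,
      exists_unique_isRLDecomp (.inl rfl) (.inl rfl) h0 h1 f⟩
  · simp only [abs_zero, isLeftRightDecomp_zero_iff, isLeftLeftDecomp_zero_iff]
    exact ⟨exists_unique_two_mul f, exists_unique_two_mul f⟩
  · have h2 : s < 1 := by linarith
    simp only [abs_of_pos h, isLeftRightDecomp_iff h h2, isLeftLeftDecomp_iff h h2]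
    exact ⟨exists_unique_isRLDecomp (.inl rfl) (.inr rfl) h hs' f,
      exists_unique_isRLDecomp (.inl rfl) (.inl rfl) h hs' f⟩
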